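/- **Theorem.** There is a function $f:\mathbb N\to\mathbb N$, $k\mapsto f_k$, with $f_k=O(2^{k/2})$ as $k\to\infty$, such that the following holds for all integers $k,n\ge 0$ and every symmetric matrix $A=(a_{uv})\in\{0,1\}^{n\times n}$ with zero diagonal and $\operatorname{rank}(A)\le k$ (the adjacency matrix of a simple graph on $[n]$). (1) Call $u,v\in[n]$ *twins* if $a_{uv}=0$ and the rows $u$ and $v$ of $A$ coincide (non-adjacent vertices with the same neighbours; each vertex is its own twin). The classes of twins can be labelled by $[f_k]$, i.e. there is a map $\mathcal P:[n]\to[f_k]$ such that $\mathcal P(u)=\mathcal P(v)$ if and only if $u$ and $v$ are twins; in particular there are at most $f_k$ classes. (2) Let $\mathcal P:[n]\to[f_k]$ be any map (for instance the one in (1)) such that vertices with the same value of $\mathcal P$ have identical rows in $A$. For $j\in[f_k]$ put $P_j=\mathcal P^{-1}(j)$ and $n_j=|P_j|$ (possibly $0$), and for $p,q\in[f_k]$ let $\tilde a_{pq}=1$ if $a_{uv}=1$ for all $u\in P_p$, $v\in P_q$, and $\tilde a_{pq}=0$ otherwise. Let $\ell_n\ge 0$ and $i_0\in[n]$. - ${\sf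 BP}(i_0)$ is the $n$-type branching process whose root has type $i_0$ and in which every particle of type $i$ has, independently for $j\in[n]$, $\mathrm{Poi}(\ell_n a_{ij})$ children of type $j$; the mark of a particle is its type. - ${\sf MBP}_{f_k}(i_0)$ is the marked $f_k$-type branching process whose root has mark $i_0$, in which every particle with mark $i$ has, independently for $j\in[f_k]$, $\mathrm{Poi}(n_j\ell_n\tilde a_{\mathcal P(i)j})$ children of type $j$, and in which every child of type $j$ independently receives a mark chosen uniformly from $P_j$. Different particles reproduce independently. Then ${\sf MBP}_{f_k}(i_0)$ and ${\sf BP}(i_0)$, each viewed as the random family tree (with unordered siblings) whose particles carry their marks in $[n]$, have the same distribution. -/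

import Mathlib

open MeasureTheory ProbabilityTheory Asymptotics Filter
open scoped NNReal

noncomputable section

namespace KotlovLovasz

/-! ### Marked family trees -/

/-- Rooted trees of height at most `d` whose particles carry a mark in `Fin n`, where siblings are
not ordered: the mark of the root, together with the multiset of the trees of its children. -/
def MarkedTree (n : ℕ) : ℕ → Type
  | 0 => Fin n
  | d + 1 => Fin n × Multiset (MarkedTree n d)

/-- There are countably many such trees, and every set of them is measurable. -/
instance (n d : ℕ) : MeasurableSpace (MarkedTree n d) := ⊤

/-! ### Marked multi-type branching processes -/

/-- The randomness attached to one individual: `count i j` is the number of its children of type `j`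
in case its own mark is `i`, and `mark j r` is the mark of its `r`-th child of type `j`. -/
abbrev Offspring (n m : ℕ) : Type := (Fin n → Fin m → ℕ) × (Fin m → ℕ → Fin n)

/-- Individuals are labelled by words (Ulam–Harris): the word `[(j₁, r₁), …, (j_g, r_g)]` is the
`r_g`-th child of type `j_g` of … of the `r₁`-th child of type `j₁` of the root `[]`. -/
abbrev Sample (n m : ℕ) : Type := List (Fin m × ℕ) → Offspring n m

/-- Law of the randomness of one individual: all the coordinates are independent, `count i j` is
Poisson with parameter `rate i j`, and `mark j r` has law `markLaw j`. -/
def offspringLaw {n m : ℕ} (rate : Fin n → Fin m → ℝ≥0) (markLaw : Fin m → PMF (Fin n)) :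
    Measure (Offspring n m) :=
  (Measure.pi fun i => Measure.pi fun j => poissonMeasure (rate i j)).prod
    (Measure.pi fun j => Measure.infinitePi fun _ : ℕ => (markLaw j).toMeasure)

instance {n m : ℕ} (rate : Fin n → Fin m → ℝ≥0) (markLaw : Fin m → PMF (Fin n)) :
    IsProbabilityMeasure (offspringLaw rate markLaw) := by
  unfold offspringLaw; infer_instance

/-- The probability measure governing the branching process: distinct individuals are
independent. -/
def sampleLaw {n m : ℕ} (rate : Fin n → Fin m → ℝ≥0) (markLaw : Fin m → PMF (Fin n)) :
    Measure (Sample n m) :=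
  Measure.infinitePi fun _ => offspringLaw rate markLaw

/-- The family tree up to generation `d`, with its marks, of a root with mark `i`. The descendants
of the `r`-th child of type `j` of the root use the part of the sample below the label `(j, r)`. -/
def familyTree {n m : ℕ} : (d : ℕ) → Sample n m → Fin n → MarkedTree n d
  | 0, _, i => i
  | d + 1, ω, i =>
      (i, ∑ j : Fin m, (Multiset.range ((ω []).1 i j)).map fun r =>
        familyTree d (fun v => ω ((j, r) :: v)) ((ω []).2 j r))

/-- The whole branching process started from a root with mark `i₀`: the sequence over `d` of its
marked family trees up to generation `d`. -/
def process {n m : ℕ} (i₀ : Fin n) (ω : Sample n m) : (d : ℕ) → MarkedTree n d :=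
  fun d => familyTree d ω i₀

/-! ### The `n`-type branching process of a matrix -/

/-- A particle of type `i` has `Poi (ℓ a_ij)` children of type `j`. -/
def bpRate {n : ℕ} (A : Matrix (Fin n) (Fin n) ℝ) (ℓ : ℝ≥0) (i j : Fin n) : ℝ≥0 :=
  ℓ * (A i j).toNNReal

/-- Law of the sample of the `n`-type process: marks and types are the same. -/
def bpLaw {n : ℕ} (A : Matrix (Fin n) (Fin n) ℝ) (ℓ : ℝ≥0) : Measure (Sample n n) :=
  sampleLaw (bpRate A ℓ) PMF.pure

/-! ### Partitions into classes of twins and the marked process with one type per class -/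

/-- Twins: non-adjacent vertices with the same neighbours (a vertex counts as its own twin). -/
def Twins {n : ℕ} (A : Matrix (Fin n) (Fin n) ℝ) (u v : Fin n) : Prop :=
  A u v = 0 ∧ ∀ w, A u w = A v w

/-- All the vertices in a class of the partition (given by its class map `P`) have identical
neighbours. -/
def IsCanonical {n m : ℕ} (A : Matrix (Fin n) (Fin n) ℝ) (P : Fin n → Fin m) : Prop :=
  ∀ u v, P u = P v → ∀ w, A u w = A v w

/-- The class with label `j`; it may be empty. -/
def cls {n m : ℕ} (P : Fin n → Fin m) (j : Fin m) : Finset (Fin n) :=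
  Finset.univ.filter fun v => P v = j

open Classical in
/-- The proxy adjacency matrix: `1` if all edges between the two classes are present, else `0`. -/
def proxy {n m : ℕ} (A : Matrix (Fin n) (Fin n) ℝ) (P : Fin n → Fin m) :
    Matrix (Fin m) (Fin m) ℝ≥0 :=
  fun p q => if ∀ u ∈ cls P p, ∀ v ∈ cls P q, A u v = 1 then 1 else 0

/-- A particle with mark `i` has `Poi (n_j ℓ ã_{P(i) j})` children of type `j`, where `n_j` is the
size of the class `j`. -/
def mbpRate {n m : ℕ} (A : Matrix (Fin n) (Fin n) ℝ) (ℓ : ℝ≥0) (P : Fin n → Fin m)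
    (i : Fin n) (j : Fin m) : ℝ≥0 :=
  ((cls P j).card : ℝ≥0) * ℓ * proxy A P (P i) j

open Classical in
/-- The mark of a particle of type `j` is uniform on the class `j`. A type with an empty class has
no particles (its Poisson parameter is `0`), and an arbitrary value `i₀` is used for it. -/
def mbpMark {n m : ℕ} (P : Fin n → Fin m) (i₀ : Fin n) (j : Fin m) : PMF (Fin n) :=
  if h : (cls P j).Nonempty then PMF.uniformOfFinset (cls P j) h else PMF.pure i₀

/-- Law of the sample of the marked process with one type per class. -/
def mbpLaw {n m : ℕ} (A : Matrix (Fin n) (Fin n) ℝ) (ℓ : ℝ≥0) (P : Fin n → Fin m)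
    (i₀ : Fin n) : Measure (Sample n m) :=
  sampleLaw (mbpRate A ℓ P) (mbpMark P i₀)

end KotlovLovasz

end

/-!
**Branching processes.** A law on finite multisets of trees is determined by its generating
functional, the expectation of `∏ z t` over the members `t`. For the multiset of the subtrees of the
root this is `exp (∑ a, λ i a * (G a - 1))`, where `λ i a` is the mean number of children with mark
`a` of an individual with mark `i`, and `G a` is the expectation of `z` at the tree of a child
with mark `a`. By induction on the generation, the means `λ` determine the law of the process. In
both processes they are `ℓ * a_ia`: for the marked process because
`n_j * ℓ * proxy * (1 / n_j) = ℓ * a_ia`, with `j` the class of `a`.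

**Twin classes** (after Kotlov and Lovász). By induction on the rank `r`, a symmetric 0-1 matrix has
at most `K * √2 ^ r - 4` distinct rows. Suppose that all rows are distinct, and let `y` be a nonzero
vector of minimal weight `h` in the row space; any two rows are at Hamming distance at least `h`.

* If `h` is at least `1 - 1/√2` times the number `N` of vertices, then the rows, read as normalized
  sign vectors, lie in a space of dimension `r + 1`, with pairwise inner products at most `√2 - 1`.
  Comparing the volume of the unit ball with that of spheroids around these vectors bounds their
  number by a multiple of `√2 ^ r`.
* If `h` is smaller and the rows of the block on the zeros of `y` are distinct, then deleting the
  support of `y` lowers the rank and divides `N` by at most `√2`.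
* If two rows agree on the zeros of `y`, then their difference is a multiple of `y`, so deleting the
  support lowers the rank by two. At most two rows of `A` restrict to any given row on the zeros,
  and the Plotkin bound shows `N ≤ 2 * N' + 4`, with `N'` the number of distinct rows of the block;
  the term `- 4` in the claim absorbs the `4`.
-/

namespace KotlovLovasz

open scoped ENNReal BoundedContinuousFunction

/-! ### Generating functionals and Poisson offspring -/

theorem measure_ext_of_submonoid {E : Type*} [TopologicalSpace E] [PolishSpace E]
    [MeasurableSpace E] [BorelSpace E] {μ ν : Measure E} [IsFiniteMeasure μ] [IsFiniteMeasure ν]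
    (S : Submonoid (E →ᵇ ℝ)) (hsep : ∀ x y, x ≠ y → ∃ g ∈ S, g x ≠ g y)
    (h : ∀ g ∈ S, ∫ x, g x ∂μ = ∫ x, g x ∂ν) : μ = ν := by
  let A : StarSubalgebra ℝ (E →ᵇ ℝ) :=
    { Algebra.adjoin ℝ (S : Set (E →ᵇ ℝ)) with
      star_mem' := fun {g} hg => by
        rwa [show star g = g from BoundedContinuousFunction.ext fun _ => star_trivial _] }
  have mem_A (g : E →ᵇ ℝ) : g ∈ A ↔ g ∈ Submodule.span ℝ (S : Set (E →ᵇ ℝ)) := by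
    change g ∈ Algebra.adjoin ℝ (S : Set (E →ᵇ ℝ)) ↔ _
    rw [← Subalgebra.mem_toSubmodule, Algebra.adjoin_eq_span, Submonoid.closure_eq]
  refine ext_of_forall_mem_subalgebra_integral_eq_of_polish (A := A) (fun x y hxy => ?_)
    fun g hg => ?_
  · obtain ⟨g, hgS, hg⟩ := hsep x y hxy
    exact ⟨g, ⟨g.toContinuousMap, ⟨g, (mem_A g).2 (Submodule.subset_span hgS), rfl⟩, rfl⟩, hg⟩
  · rw [mem_A] at hg
    induction hg using Submodule.span_induction with
    | mem g hg => exact h g hg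
    | zero => simp
    | add f g _ _ hf hg =>
      simp only [BoundedContinuousFunction.coe_add, Pi.add_apply]
      rw [integral_add (f.integrable _) (g.integrable _),
        integral_add (f.integrable _) (g.integrable _), hf, hg]
    | smul c f _ hf =>
      simp only [BoundedContinuousFunction.coe_smul, smul_eq_mul]
      rw [integral_const_mul, integral_const_mul, hf]

theorem prod_map_ite_eq_pow_count {X R : Type*} [DecidableEq X] [CommMonoid R] (x : X) (c : R)
    (M : Multiset X) : (M.map fun y => if y = x then c else 1).prod = c ^ M.count x := by
  rw [Multiset.prod_map_eq_pow_single x fun y hy _ => if_neg hy, if_pos rfl]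

theorem measure_multiset_ext {X : Type*} [Countable X]
    [MeasurableSpace (Multiset X)] [DiscreteMeasurableSpace (Multiset X)]
    {μ ν : Measure (Multiset X)} [IsFiniteMeasure μ] [IsFiniteMeasure ν]
    (h : ∀ z : X → ℝ≥0, z ≤ 1 →
      ∫⁻ M, ((M.map z).prod : ℝ≥0) ∂μ = ∫⁻ M, ((M.map z).prod : ℝ≥0) ∂ν) : μ = ν := by
  classical
  let _ : TopologicalSpace (Multiset X) := ⊥
  have : DiscreteTopology (Multiset X) := ⟨rfl⟩
  let S : Submonoid (Multiset X →ᵇ ℝ) :=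
    { carrier := {g | ∃ z : X → ℝ≥0, z ≤ 1 ∧ ∀ M, g M = (M.map z).prod}
      one_mem' := ⟨1, le_rfl, fun M => by simp⟩
      mul_mem' := by
        rintro f g ⟨z, hz, hf⟩ ⟨y, hy, hg⟩
        exact ⟨z * y, mul_le_one' hz hy, fun M => by simp [hf, hg, Multiset.prod_map_mul]⟩ }
  refine measure_ext_of_submonoid S (fun M N hMN => ?_) ?_
  · obtain ⟨x, hx⟩ : ∃ x, M.count x ≠ N.count x := by
      simpa [Multiset.ext] using hMN
    let z : X → ℝ≥0 := fun y => if y = x then 2⁻¹ else 1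
    have prod_z (K : Multiset X) : (K.map z).prod = 2⁻¹ ^ K.count x :=
      prod_map_ite_eq_pow_count x 2⁻¹ K
    let g : Multiset X →ᵇ ℝ := .ofNormedAddCommGroupDiscrete (fun K => (K.map z).prod) 1 fun K => by
      rw [prod_z, NNReal.norm_eq]
      exact NNReal.coe_le_one.2 (pow_le_one₀ zero_le (inv_le_one_of_one_le₀ one_le_two))
    have hz : z ≤ 1 := fun y => by
      simp only [z, Pi.one_apply]
      split_ifs
      exacts [inv_le_one_of_one_le₀ one_le_two, le_rfl]
    refine ⟨g, ⟨z, hz, fun K => rfl⟩, fun hg => hx ?_⟩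
    have hpow : (2⁻¹ : ℝ≥0) ^ M.count x = 2⁻¹ ^ N.count x := by
      rw [← prod_z, ← prod_z]
      exact NNReal.coe_injective hg
    exact pow_right_injective₀ (by positivity) (by norm_num) hpow
  · rintro g ⟨z, hz, hg⟩
    have integral_g (ρ : Measure (Multiset X)) :
        ∫ M, g M ∂ρ = (∫⁻ M, ((M.map z).prod : ℝ≥0) ∂ρ).toReal := by
      simp_rw [hg]
      rw [integral_eq_lintegral_of_nonneg_ae (ae_of_all _ fun M => NNReal.coe_nonneg _)
        Measurable.of_discrete.aestronglyMeasurable]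
      simp only [ENNReal.ofReal_coe_nnreal]
    rw [integral_g, integral_g, h z hz]

theorem lintegral_pow_poissonMeasure (r g : ℝ≥0) :
    ∫⁻ k, (g : ℝ≥0∞) ^ k ∂poissonMeasure r = ENNReal.ofReal (Real.exp (r * (g - 1))) := by
  have hsum : HasSum (fun k : ℕ => (g : ℝ) ^ k * (Real.exp (-r) * r ^ k / k.factorial))
      (Real.exp (r * (g - 1))) := by
    have h := (NormedSpace.expSeries_div_hasSum_exp (𝔸 := ℝ) (r * g)).mul_left (Real.exp (-r))
    rw [← Real.exp_eq_exp_ℝ, ← Real.exp_add] at h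
    convert! h using 1
    · ext k
      rw [mul_pow]; ring
    · ring_nf
  rw [lintegral_countable', ← hsum.tsum_eq,
    ENNReal.ofReal_tsum_of_nonneg (fun k => by positivity) hsum.summable]
  congr 1 with k
  rw [poissonMeasure_singleton, ENNReal.ofReal_mul (by positivity),
    ENNReal.ofReal_pow g.coe_nonneg, ENNReal.ofReal_coe_nnreal]

theorem lintegral_infinitePi_prod {ι : Type*} {X : ι → Type*} [∀ i, MeasurableSpace (X i)]
    (μ : ∀ i, Measure (X i)) [∀ i, IsProbabilityMeasure (μ i)] (s : Finset ι)
    {f : ∀ i, X i → ℝ≥0∞} (hf : ∀ i, Measurable (f i)) :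
    ∫⁻ ω, ∏ i ∈ s, f i (ω i) ∂Measure.infinitePi μ = ∏ i ∈ s, ∫⁻ x, f i x ∂μ i := by
  rw [lintegral_prod_eq_prod_lintegral_of_indepFun s _ (iIndepFun_infinitePi hf)
    fun i => (hf i).comp (measurable_pi_apply i)]
  exact Finset.prod_congr rfl fun i _ =>
    (measurePreserving_eval_infinitePi μ i).lintegral_comp (hf i)

theorem lintegral_infinitePi_prod_range {ι X : Type*} [Fintype ι] [MeasurableSpace X]
    (μ : ι → Measure X) [∀ i, IsProbabilityMeasure (μ i)] {f : X → ℝ≥0∞} (hf : Measurable f)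
    (c : ι → ℕ) :
    ∫⁻ ω, ∏ i, ∏ r ∈ Finset.range (c i), f (ω i r)
      ∂(Measure.pi fun i => Measure.infinitePi fun _ : ℕ => μ i) = ∏ i, (∫⁻ x, f x ∂μ i) ^ c i := by
  rw [← Measure.infinitePi_eq_pi]
  refine (lintegral_infinitePi_prod _ Finset.univ
    (f := fun i (ω : ℕ → X) => ∏ r ∈ Finset.range (c i), f (ω r)) fun i => by fun_prop).trans ?_
  simp only [lintegral_infinitePi_prod _ _ fun _ => hf, Finset.prod_const, Finset.card_range]

theorem indepFun_eval_infinitePi {ι α : Type*} {X : ι → Type*} [∀ i, MeasurableSpace (X i)]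
    (μ : ∀ i, Measure (X i)) [∀ i, IsProbabilityMeasure (μ i)] {i : ι} {f : α → ι}
    (hi : i ∉ Set.range f) :
    IndepFun (fun ω => ω i) (fun ω a => ω (f a)) (Measure.infinitePi μ) := by
  have hindep := indep_iSup_of_disjoint (fun k => (measurable_pi_apply k).comap_le)
    (iIndepFun_infinitePi (P := μ) fun _ => measurable_id) (Set.disjoint_singleton_left.2 hi)
  refine indep_of_indep_of_le_left (indep_of_indep_of_le_right hindep ?_) ?_
  · simp only [MeasurableSpace.pi, MeasurableSpace.comap_iSup, MeasurableSpace.comap_comp,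
      iSup_range]
    rfl
  · simp only [Set.mem_singleton_iff, iSup_iSup_eq_left]
    rfl

theorem map_root_subtrees_infinitePi {α S : Type*} [MeasurableSpace S] (μ : Measure S)
    [IsProbabilityMeasure μ] :
    (Measure.infinitePi fun _ : List α => μ).map (fun ω => (ω [], fun p v => ω (p :: v))) =
      μ.prod (Measure.infinitePi fun _ : α => Measure.infinitePi fun _ : List α => μ) := by
  let uncons (p : α × List α) : List α := p.1 :: p.2
  have uncons_injective : Function.Injective uncons := fun p q hpq =>
    Prod.ext (List.cons.inj hpq).1 (List.cons.inj hpq).2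
  have nil_notMem_range : [] ∉ Set.range uncons := fun ⟨_, hp⟩ => List.cons_ne_nil _ _ hp
  have root_indep_subtrees : IndepFun (fun ω : List α → S => ω []) (fun ω p v => ω (p :: v))
      (Measure.infinitePi fun _ : List α => μ) :=
    (indepFun_eval_infinitePi (fun _ => μ) nil_notMem_range).comp measurable_id
      (MeasurableEquiv.curry α (List α) S).measurable
  have subtrees_law : (Measure.infinitePi fun _ : List α => μ).map (fun ω p v => ω (p :: v)) =
      Measure.infinitePi fun _ : α => Measure.infinitePi fun _ : List α => μ := by
    rw [← Measure.infinitePi_map_curry fun (_ : α) (_ : List α) => μ,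
      ← Measure.map_infinitePi_infinitePi_of_inj (P := fun _ : List α => μ) uncons_injective,
      Measure.map_map (by fun_prop) (by fun_prop)]
    rfl
  rw [root_indep_subtrees.map_prod_eq_prod_map_map (measurable_pi_apply _).aemeasurable
      (Measurable.aemeasurable (by fun_prop)), Measure.infinitePi_map_eval, subtrees_law]

theorem measurable_apply_of_countable {Ω C Y : Type*} [MeasurableSpace Ω] [MeasurableSpace C]
    [Countable C] [MeasurableSingletonClass C] [MeasurableSpace Y] {F : C → Ω → Y} {c : Ω → C}
    (hF : ∀ k, Measurable (F k)) (hc : Measurable c) : Measurable fun ω => F (c ω) ω :=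
  (measurable_from_prod_countable_right (f := fun q : C × Ω => F q.1 q.2) hF).comp
    (hc.prodMk measurable_id)

instance (n d : ℕ) : DiscreteMeasurableSpace (MarkedTree n d) := ⟨fun _ => trivial⟩

instance instCountableMarkedTree (n : ℕ) : ∀ d, Countable (MarkedTree n d)
  | 0 => inferInstanceAs (Countable (Fin n))
  | d + 1 =>
    have := instCountableMarkedTree n d
    inferInstanceAs (Countable (Fin n × Multiset (MarkedTree n d)))

instance (n d : ℕ) : MeasurableSpace (Multiset (MarkedTree n d)) := ⊤

instance (n d : ℕ) : DiscreteMeasurableSpace (Multiset (MarkedTree n d)) := ⟨fun _ => trivial⟩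

/-! ### Family trees -/

section FamilyTree

variable {n m : ℕ}

/-- The tree whose root has mark `i` and whose multiset of subtrees is `M`. -/
def MarkedTree.node {d : ℕ} (i : Fin n) (M : Multiset (MarkedTree n d)) : MarkedTree n (d + 1) :=
  (i, M)

/-- The labels of the children of an individual that has `c j` children of type `j`. -/
def childLabels (c : Fin m → ℕ) : Finset (Fin m × ℕ) :=
  (Finset.univ.sigma fun j => Finset.range (c j)).map (Equiv.sigmaEquivProd (Fin m) ℕ).toEmbedding

@[to_additive]
theorem prod_childLabels {R : Type*} [CommMonoid R] (c : Fin m → ℕ) (f : Fin m × ℕ → R) :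
    ∏ p ∈ childLabels c, f p = ∏ j, ∏ r ∈ Finset.range (c j), f (j, r) := by
  rw [childLabels, Finset.prod_map, Finset.prod_sigma]
  rfl

/-- The family trees up to generation `d` of the children of an individual with mark `i`, whose own
randomness is `o` and whose child with label `p` has the sample `η p`. -/
def childTrees (d : ℕ) (i : Fin n) (o : Offspring n m) (η : Fin m × ℕ → Sample n m) :
    Multiset (MarkedTree n d) :=
  ∑ p ∈ childLabels (o.1 i), {familyTree d (η p) (o.2 p.1 p.2)}

theorem familyTree_succ (d : ℕ) (ω : Sample n m) (i : Fin n) :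
    familyTree (d + 1) ω i =
      MarkedTree.node i (childTrees d i (ω []) fun p v => ω (p :: v)) := by
  refine congrArg (MarkedTree.node i) ?_
  rw [childTrees, sum_childLabels]
  refine Finset.sum_congr rfl fun j _ => ?_
  rw [← Multiset.sum_map_singleton (Multiset.map _ _), Multiset.map_map]
  rfl

theorem measurable_childTrees_of_familyTree {d : ℕ}
    (h : ∀ i, Measurable fun ω : Sample n m => familyTree d ω i) (i : Fin n) :
    Measurable fun q : Offspring n m × (Fin m × ℕ → Sample n m) => childTrees d i q.1 q.2 := by
  refine measurable_apply_of_countable (F := fun (c : Fin m → ℕ)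
    (q : Offspring n m × (Fin m × ℕ → Sample n m)) =>
      ∑ p ∈ childLabels c, {familyTree d (q.2 p) (q.1.2 p.1 p.2)})
    (fun c => Finset.measurable_fun_sum _ fun p _ => ?_) (by fun_prop)
  have measurable_subtree : Measurable fun q : Offspring n m × (Fin m × ℕ → Sample n m) =>
      familyTree d (q.2 p) (q.1.2 p.1 p.2) :=
    measurable_apply_of_countable
      (F := fun a (q : _ × (Fin m × ℕ → Sample n m)) => familyTree d (q.2 p) a)
      (fun a => (h a).comp (by fun_prop)) (by fun_prop)
  exact (Measurable.of_discrete (f := fun t : MarkedTree n d => ({t} : Multiset _))).comp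
    measurable_subtree

theorem measurable_familyTree (d : ℕ) (i : Fin n) :
    Measurable fun ω : Sample n m => familyTree d ω i := by
  induction d generalizing i with
  | zero => exact measurable_const
  | succ d ih =>
    simp only [familyTree_succ]
    exact (Measurable.of_discrete (f := MarkedTree.node i)).comp
      ((measurable_childTrees_of_familyTree ih i).comp
        (f := fun ω : Sample n m => (ω [], fun p v => ω (p :: v))) (by fun_prop))

theorem measurable_childTrees (d : ℕ) (i : Fin n) :
    Measurable fun q : Offspring n m × (Fin m × ℕ → Sample n m) => childTrees d i q.1 q.2 :=
  measurable_childTrees_of_familyTree (measurable_familyTree d) i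

theorem measurable_process (i₀ : Fin n) : Measurable (process i₀ : Sample n m → _) :=
  measurable_pi_iff.2 fun d => measurable_familyTree d i₀

/-- The part of a tree up to generation `d`, for a tree of height at most `d + 1`. -/
def MarkedTree.truncate : (d : ℕ) → MarkedTree n (d + 1) → MarkedTree n d
  | 0, (i, _) => i
  | d + 1, (i, M) => (i, M.map (truncate d))

theorem truncate_familyTree (d : ℕ) (ω : Sample n m) (i : Fin n) :
    MarkedTree.truncate d (familyTree (d + 1) ω i) = familyTree d ω i := by
  induction d generalizing ω i with
  | zero => rfl
  | succ d ih =>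
    rw [familyTree_succ, familyTree_succ]
    refine congrArg (MarkedTree.node i) ?_
    simp only [childTrees, ← Multiset.coe_mapAddMonoidHom, map_sum]
    simp only [Multiset.coe_mapAddMonoidHom, Multiset.map_singleton, ih]

theorem exists_truncate_familyTree_of_le (n : ℕ) {d e : ℕ} (hde : d ≤ e) :
    ∃ τ : MarkedTree n e → MarkedTree n d, ∀ (m : ℕ) (ω : Sample n m) (i : Fin n),
      τ (familyTree e ω i) = familyTree d ω i := by
  induction e, hde using Nat.le_induction with
  | base => exact ⟨id, fun _ _ _ => rfl⟩
  | succ e _ ih =>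
    obtain ⟨τ, hτ⟩ := ih
    exact ⟨τ ∘ MarkedTree.truncate e, fun m ω i => by
      rw [Function.comp_apply, truncate_familyTree, hτ]⟩

end FamilyTree

section Intensity

variable {n m : ℕ} (rate : Fin n → Fin m → ℝ≥0) (markLaw : Fin m → PMF (Fin n))

/-- The mean number of children with mark `a` of an individual with mark `i`. -/
def intensity (i a : Fin n) : ℝ≥0 :=
  ∑ j, rate i j * (markLaw j a).toNNReal

theorem lintegral_toMeasure_eq_sum {α : Type*} [Fintype α] [MeasurableSpace α]
    [MeasurableSingletonClass α] (p : PMF α) (G : α → ℝ≥0) :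
    ∫⁻ a, G a ∂p.toMeasure = ((∑ a, (p a).toNNReal * G a : ℝ≥0) : ℝ≥0∞) := by
  rw [lintegral_fintype, ENNReal.ofNNReal_finsetSum]
  refine Finset.sum_congr rfl fun a _ => ?_
  rw [PMF.toMeasure_apply_singleton _ _ (measurableSet_singleton a), ENNReal.coe_mul,
    ENNReal.coe_toNNReal (p.apply_ne_top a), mul_comm]

theorem sum_toNNReal_pmf {α : Type*} [Fintype α] (p : PMF α) : ∑ a, (p a).toNNReal = 1 := by
  rw [← ENNReal.toNNReal_sum fun a _ => p.apply_ne_top a, ← tsum_fintype (L := .unconditional _),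
    p.tsum_coe, ENNReal.toNNReal_one]

theorem lintegral_prod_childLabels_offspringLaw (i : Fin n) (G : Fin n → ℝ≥0∞) :
    ∫⁻ o, ∏ p ∈ childLabels (o.1 i), G (o.2 p.1 p.2) ∂offspringLaw rate markLaw =
      ∏ j, ∫⁻ k, (∫⁻ a, G a ∂(markLaw j).toMeasure) ^ k ∂poissonMeasure (rate i j) := by
  have hmeas : Measurable fun o : Offspring n m =>
      ∏ p ∈ childLabels (o.1 i), G (o.2 p.1 p.2) :=
    measurable_apply_of_countable (F := fun (c : Fin m → ℕ) (o : Offspring n m) =>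
      ∏ p ∈ childLabels c, G (o.2 p.1 p.2))
      (fun c => Finset.measurable_fun_prod _ fun p _ =>
        (Measurable.of_discrete (f := G)).comp (by fun_prop)) (by fun_prop)
  rw [offspringLaw, lintegral_prod _ hmeas.aemeasurable]
  simp_rw [prod_childLabels, lintegral_infinitePi_prod_range _ (Measurable.of_discrete (f := G))]
  rw [(measurePreserving_eval (fun i => Measure.pi fun j => poissonMeasure (rate i j))
    i).lintegral_comp (f := fun c => ∏ j, (∫⁻ a, G a ∂(markLaw j).toMeasure) ^ c j)
    Measurable.of_discrete, ← Measure.infinitePi_eq_pi]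
  exact lintegral_infinitePi_prod _ _ fun j => Measurable.of_discrete

theorem lintegral_prod_childLabels_eq_exp_intensity (i : Fin n) (G : Fin n → ℝ≥0) :
    ∫⁻ o, ∏ p ∈ childLabels (o.1 i), (G (o.2 p.1 p.2) : ℝ≥0∞) ∂offspringLaw rate markLaw =
      ENNReal.ofReal (Real.exp (∑ a, intensity rate markLaw i a * (G a - 1))) := by
  rw [lintegral_prod_childLabels_offspringLaw rate markLaw i fun a => G a]
  simp_rw [lintegral_toMeasure_eq_sum, lintegral_pow_poissonMeasure]
  rw [← ENNReal.ofReal_prod_of_nonneg fun j _ => (Real.exp_pos _).le, ← Real.exp_sum]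
  congr 2
  have mark_mean_sub_one (j : Fin m) :
      ((∑ a, (markLaw j a).toNNReal * G a : ℝ≥0) : ℝ) - 1 =
        ∑ a, ((markLaw j a).toNNReal : ℝ) * (G a - 1) := by
    have hone := congrArg NNReal.toReal (sum_toNNReal_pmf (markLaw j))
    push_cast at hone ⊢
    simp only [mul_sub, mul_one, Finset.sum_sub_distrib, hone]
  simp_rw [mark_mean_sub_one, intensity, NNReal.coe_sum, NNReal.coe_mul, Finset.mul_sum,
    Finset.sum_mul, mul_assoc]
  exact Finset.sum_comm

instance : IsProbabilityMeasure (sampleLaw rate markLaw) := by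
  unfold sampleLaw; infer_instance

theorem map_root_subtrees_sampleLaw :
    (sampleLaw rate markLaw).map (fun ω => (ω [], fun p v => ω (p :: v))) =
      (offspringLaw rate markLaw).prod (Measure.infinitePi fun _ => sampleLaw rate markLaw) :=
  map_root_subtrees_infinitePi _

theorem coe_prod_map_childTrees {d : ℕ} (z : MarkedTree n d → ℝ≥0) (i : Fin n)
    (o : Offspring n m) (η : Fin m × ℕ → Sample n m) :
    ((((childTrees d i o η).map z).prod : ℝ≥0) : ℝ≥0∞) =
      ∏ p ∈ childLabels (o.1 i), (z (familyTree d (η p) (o.2 p.1 p.2)) : ℝ≥0∞) := by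
  rw [childTrees, ← Multiset.coe_mapAddMonoidHom, map_sum, Multiset.prod_sum,
    ENNReal.ofNNReal_finsetProd]
  simp only [Multiset.coe_mapAddMonoidHom, Multiset.map_singleton, Multiset.prod_singleton]

theorem lintegral_prod_map_childTrees {d : ℕ} {z : MarkedTree n d → ℝ≥0} (G : Fin n → ℝ≥0)
    (hG : ∀ a, ∫⁻ ω, z (familyTree d ω a) ∂sampleLaw rate markLaw = G a) (i : Fin n) :
    ∫⁻ q, (((childTrees d i q.1 q.2).map z).prod : ℝ≥0)
        ∂(offspringLaw rate markLaw).prod (Measure.infinitePi fun _ => sampleLaw rate markLaw) =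
      ENNReal.ofReal (Real.exp (∑ a, intensity rate markLaw i a * (G a - 1))) := by
  have measurable_z (a : Fin n) : Measurable fun ω : Sample n m => (z (familyTree d ω a) : ℝ≥0∞) :=
    (Measurable.of_discrete (f := fun t => (z t : ℝ≥0∞))).comp (measurable_familyTree d a)
  have measurable_prod : Measurable fun q : Offspring n m × (Fin m × ℕ → Sample n m) =>
      ((((childTrees d i q.1 q.2).map z).prod : ℝ≥0) : ℝ≥0∞) :=
    (Measurable.of_discrete (f := fun M : Multiset (MarkedTree n d) =>
      (((M.map z).prod : ℝ≥0) : ℝ≥0∞))).comp (measurable_childTrees d i)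
  rw [lintegral_prod _ measurable_prod.aemeasurable]
  simp_rw [coe_prod_map_childTrees]
  rw [← lintegral_prod_childLabels_eq_exp_intensity]
  refine lintegral_congr fun o => ?_
  refine (lintegral_infinitePi_prod _ (childLabels (o.1 i))
    (f := fun p ω => (z (familyTree d ω (o.2 p.1 p.2)) : ℝ≥0∞))
    fun p => measurable_z _).trans ?_
  simp only [hG]

end Intensity

section EqualIntensities

variable {n m m' : ℕ} {rate : Fin n → Fin m → ℝ≥0} {markLaw : Fin m → PMF (Fin n)}
  {rate' : Fin n → Fin m' → ℝ≥0} {markLaw' : Fin m' → PMF (Fin n)}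

theorem map_childTrees_eq_of_intensity_eq (h : intensity rate markLaw = intensity rate' markLaw')
    {d : ℕ} (hd : ∀ a, (sampleLaw rate markLaw).map (fun ω => familyTree d ω a) =
      (sampleLaw rate' markLaw').map (fun ω => familyTree d ω a)) (i : Fin n) :
    ((offspringLaw rate markLaw).prod (Measure.infinitePi fun _ => sampleLaw rate markLaw)).map
        (fun q => childTrees d i q.1 q.2) =
      ((offspringLaw rate' markLaw').prod
        (Measure.infinitePi fun _ => sampleLaw rate' markLaw')).map
        (fun q => childTrees d i q.1 q.2) := by
  refine measure_multiset_ext fun z hz => ?_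
  have measurable_z : Measurable fun t : MarkedTree n d => (z t : ℝ≥0∞) := Measurable.of_discrete
  let G (a : Fin n) : ℝ≥0 := (∫⁻ ω, z (familyTree d ω a) ∂sampleLaw rate markLaw).toNNReal
  have hG (a : Fin n) : ∫⁻ ω, z (familyTree d ω a) ∂sampleLaw rate markLaw = G a := by
    refine (ENNReal.coe_toNNReal (ne_top_of_le_ne_top ENNReal.one_ne_top ?_)).symm
    exact (lintegral_mono fun ω => ENNReal.coe_le_one_iff.2 (hz _)).trans_eq (by simp)
  have hG' (a : Fin n) : ∫⁻ ω, z (familyTree d ω a) ∂sampleLaw rate' markLaw' = G a := by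
    rw [← hG, ← lintegral_map measurable_z (measurable_familyTree d a), ← hd,
      lintegral_map measurable_z (measurable_familyTree d a)]
  rw [lintegral_map Measurable.of_discrete (measurable_childTrees d i),
    lintegral_map Measurable.of_discrete (measurable_childTrees d i),
    lintegral_prod_map_childTrees rate markLaw G hG,
    lintegral_prod_map_childTrees rate' markLaw' G hG', h]

theorem map_familyTree_eq_of_intensity_eq (h : intensity rate markLaw = intensity rate' markLaw')
    (d : ℕ) (i : Fin n) :
    (sampleLaw rate markLaw).map (fun ω => familyTree d ω i) =
      (sampleLaw rate' markLaw').map (fun ω => familyTree d ω i) := by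
  induction d generalizing i with
  | zero =>
    change Measure.map (fun _ => (i : MarkedTree n 0)) _ = Measure.map (fun _ => i) _
    simp only [Measure.map_const, measure_univ]
  | succ d ih =>
    have map_succ {k : ℕ} (r : Fin n → Fin k → ℝ≥0) (p : Fin k → PMF (Fin n)) :
        (sampleLaw r p).map (fun ω => familyTree (d + 1) ω i) =
          (((offspringLaw r p).prod (Measure.infinitePi fun _ => sampleLaw r p)).map
            fun q => childTrees d i q.1 q.2).map (MarkedTree.node i) := by
      rw [← map_root_subtrees_sampleLaw, Measure.map_map (measurable_childTrees d i)
        (by fun_prop), Measure.map_map Measurable.of_discrete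
        ((measurable_childTrees d i).comp (by fun_prop))]
      simp only [familyTree_succ]
      rfl
    rw [map_succ, map_succ, map_childTrees_eq_of_intensity_eq h ih]

theorem identDistrib_process_of_intensity_eq
    (h : intensity rate markLaw = intensity rate' markLaw') (i₀ : Fin n) :
    IdentDistrib (process i₀) (process i₀) (sampleLaw rate markLaw) (sampleLaw rate' markLaw') := by
  refine ⟨(measurable_process i₀).aemeasurable, (measurable_process i₀).aemeasurable, ?_⟩
  have := Measure.isProbabilityMeasure_map (μ := sampleLaw rate markLaw)
    (measurable_process i₀).aemeasurable
  refine IsProjectiveLimit.unique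
    (P := fun I => ((sampleLaw rate markLaw).map (process i₀)).map I.restrict)
    (fun _ => rfl) fun I => (?_ : _ = ((sampleLaw rate markLaw).map (process i₀)).map I.restrict)
  choose τ hτ using fun d : I =>
    exists_truncate_familyTree_of_le n (Finset.le_sup (f := id) d.2 : (d : ℕ) ≤ I.sup id)
  have map_restrict {k : ℕ} (ρ : Measure (Sample n k)) : (ρ.map (process i₀)).map I.restrict =
      (ρ.map fun ω => familyTree (I.sup id) ω i₀).map fun t d => τ d t := by
    rw [Measure.map_map (Finset.measurable_restrict I) (measurable_process i₀),
      Measure.map_map Measurable.of_discrete (measurable_familyTree _ i₀)]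
    congr 1
    ext ω d
    exact (hτ d k ω i₀).symm
  rw [map_restrict, map_restrict, map_familyTree_eq_of_intensity_eq h]

end EqualIntensities

section TwinClasses

variable {n m : ℕ} {A : Matrix (Fin n) (Fin n) ℝ} {P : Fin n → Fin m}

theorem mem_cls {j : Fin m} {v : Fin n} : v ∈ cls P j ↔ P v = j := by
  simp [cls]

theorem intensity_bpRate_pure (ℓ : ℝ≥0) (i a : Fin n) :
    intensity (bpRate A ℓ) PMF.pure i a = ℓ * (A i a).toNNReal := by
  rw [intensity, Finset.sum_eq_single a]
  · simp [bpRate]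
  · intro j _ hj
    simp [PMF.pure_apply, hj.symm]
  · simp

theorem proxy_eq_toNNReal (hsymm : A.IsSymm) (h01 : ∀ u v, A u v = 0 ∨ A u v = 1)
    (hP : IsCanonical A P) (u v : Fin n) : proxy A P (P u) (P v) = (A u v).toNNReal := by
  have all_edges_iff : (∀ x ∈ cls P (P u), ∀ y ∈ cls P (P v), A x y = 1) ↔ A u v = 1 := by
    refine ⟨fun h => h u (mem_cls.2 rfl) v (mem_cls.2 rfl), fun h x hx y hy => ?_⟩
    rw [hP x u (mem_cls.1 hx), hsymm.apply, hP y v (mem_cls.1 hy), hsymm.apply, h]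
  rw [proxy]
  rcases h01 u v with h | h <;> simp [all_edges_iff, h]

theorem intensity_mbpRate_mbpMark (ℓ : ℝ≥0) (i₀ i a : Fin n) :
    intensity (mbpRate A ℓ P) (mbpMark P i₀) i a = ℓ * proxy A P (P i) (P a) := by
  have ha : a ∈ cls P (P a) := mem_cls.2 rfl
  have hne : (cls P (P a)).Nonempty := ⟨a, ha⟩
  rw [intensity, Finset.sum_eq_single (P a)]
  · have hcard : ((cls P (P a)).card : ℝ≥0) ≠ 0 := Nat.cast_ne_zero.2 hne.card_ne_zero
    rw [mbpMark, dif_pos hne, PMF.uniformOfFinset_apply_of_mem hne ha, mbpRate,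
      ENNReal.toNNReal_inv, ENNReal.toNNReal_natCast]
    field_simp
  · intro j _ hj
    by_cases hjne : (cls P j).Nonempty
    · rw [mbpMark, dif_pos hjne, PMF.uniformOfFinset_apply_of_notMem hjne (by
        rw [mem_cls]; exact hj.symm)]
      simp
    · simp [mbpRate, Finset.not_nonempty_iff_eq_empty.1 hjne]
  · simp

theorem identDistrib_process_mbpLaw_bpLaw (hsymm : A.IsSymm)
    (h01 : ∀ u v, A u v = 0 ∨ A u v = 1) (hP : IsCanonical A P) (ℓ : ℝ≥0) (i₀ : Fin n) :
    IdentDistrib (process i₀) (process i₀) (mbpLaw A ℓ P i₀) (bpLaw A ℓ) := by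
  refine identDistrib_process_of_intensity_eq ?_ i₀
  ext i a
  rw [intensity_mbpRate_mbpMark, intensity_bpRate_pure, proxy_eq_toNNReal hsymm h01 hP]

end TwinClasses

/-! ### Spherical and binary codes -/

section SphericalCode

open scoped RealInnerProductSpace

theorem sum_measure_le_of_card_mem_le {X ι : Type*} [MeasurableSpace X] [Fintype ι]
    (μ : Measure X) {C : ι → Set X} {B : Set X} {M : ℝ≥0∞} (hC : ∀ i, MeasurableSet (C i))
    (hB : MeasurableSet B) (hCB : ∀ i, C i ⊆ B)
    (hM : ∀ x ∈ B, ∀ I : Finset ι, (∀ i ∈ I, x ∈ C i) → (I.card : ℝ≥0∞) ≤ M) :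
    ∑ i, μ (C i) ≤ M * μ B := by
  classical
  calc ∑ i, μ (C i) = ∑ i, ∫⁻ x, (C i).indicator 1 x ∂μ :=
        Finset.sum_congr rfl fun i _ => (lintegral_indicator_one (hC i)).symm
    _ = ∫⁻ x, ∑ i, (C i).indicator 1 x ∂μ :=
        (lintegral_finsetSum _ fun i _ => measurable_one.indicator (hC i)).symm
    _ ≤ ∫⁻ x, B.indicator (fun _ => M) x ∂μ := by
        refine lintegral_mono fun x => ?_
        by_cases hx : x ∈ B
        · simpa [Set.indicator_apply, hx] using
            hM x hx (Finset.univ.filter fun i => x ∈ C i) fun i hi => (Finset.mem_filter.1 hi).2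
        · have notMem_C (i : ι) : x ∉ C i := fun hi => hx (hCB i hi)
          simp [hx, notMem_C]
    _ = M * μ B := lintegral_indicator_const hB M

variable {E ι : Type*} [NormedAddCommGroup E] [InnerProductSpace ℝ E]

theorem card_mul_le_of_le_inner {v : ι → E} {s t : ℝ} (hv : ∀ i, ‖v i‖ = 1)
    (hvs : ∀ i j, i ≠ j → ⟪v i, v j⟫ ≤ s) (hs : s ≤ 1) (ht : 0 ≤ t) {x : E} (hx : ‖x‖ ≤ 1)
    {I : Finset ι} (hI : ∀ i ∈ I, t ≤ ⟪v i, x⟫) : I.card * (t ^ 2 - s) ≤ 1 - s := by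
  classical
  rcases I.eq_empty_or_nonempty with rfl | hne
  · simpa using hs
  have lower : I.card * t ≤ ‖∑ i ∈ I, v i‖ := by
    calc (I.card : ℝ) * t = ∑ _i ∈ I, t := by rw [Finset.sum_const, nsmul_eq_mul]
      _ ≤ ∑ i ∈ I, ⟪v i, x⟫ := Finset.sum_le_sum hI
      _ = ⟪∑ i ∈ I, v i, x⟫ := (sum_inner _ _ _).symm
      _ ≤ ‖∑ i ∈ I, v i‖ * ‖x‖ := real_inner_le_norm _ _
      _ ≤ ‖∑ i ∈ I, v i‖ := mul_le_of_le_one_right (norm_nonneg _) hx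
  have upper : ‖∑ i ∈ I, v i‖ ^ 2 ≤ I.card * (I.card * s + (1 - s)) := by
    rw [← real_inner_self_eq_norm_sq, sum_inner, ← nsmul_eq_mul]
    refine Finset.sum_le_card_nsmul _ _ _ fun i hi => ?_
    rw [inner_sum]
    calc ∑ j ∈ I, ⟪v i, v j⟫ ≤ ∑ j ∈ I, (s + if i = j then 1 - s else 0) := by
          refine Finset.sum_le_sum fun j _ => ?_
          split_ifs with hij
          · rw [← hij, real_inner_self_eq_norm_sq, hv]
            linarith
          · simpa using hvs i j hij
      _ = I.card * s + (1 - s) := by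
          rw [Finset.sum_add_distrib, Finset.sum_ite_eq, if_pos hi, Finset.sum_const, nsmul_eq_mul]
  have hcard : (0 : ℝ) < I.card := Nat.cast_pos.2 hne.card_pos
  have squared : ((I.card : ℝ) * t) ^ 2 ≤ ‖∑ i ∈ I, v i‖ ^ 2 :=
    pow_le_pow_left₀ (by positivity) lower 2
  refine le_of_mul_le_mul_left ?_ hcard
  linarith

/-- The linear map which scales the direction of the unit vector `v` by `a` and its orthogonal
complement by `b ≠ 0`. -/
noncomputable def spheroidMap (a b : ℝ) (v : E) : E →ₗ[ℝ] E :=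
  b • LinearMap.transvection (((a - b) / b) • (innerSL ℝ v : E →ₗ[ℝ] ℝ)) v

theorem spheroidMap_apply (a : ℝ) {b : ℝ} (hb : b ≠ 0) (v y : E) :
    spheroidMap a b v y = b • y + ((a - b) * ⟪v, y⟫) • v := by
  simp only [spheroidMap, LinearMap.smul_apply, LinearMap.transvection.apply, smul_add, smul_smul,
    ContinuousLinearMap.coe_coe, innerSL_apply_apply, smul_eq_mul]
  congr 2
  field_simp

theorem det_spheroidMap [FiniteDimensional ℝ E] (a : ℝ) {b : ℝ} (hb : b ≠ 0) {v : E}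
    (hv : ‖v‖ = 1) : (spheroidMap a b v).det = b ^ Module.finrank ℝ E * (a / b) := by
  rw [spheroidMap, LinearMap.det_smul, LinearMap.transvection.det]
  simp only [LinearMap.smul_apply, ContinuousLinearMap.coe_coe, innerSL_apply_apply, smul_eq_mul,
    real_inner_self_eq_norm_sq, hv]
  field_simp
  ring

theorem norm_smul_add_spheroidMap_le_one {a b c : ℝ} (ha : 0 ≤ a) (hb : b ≠ 0) (hc : 0 ≤ c)
    (habc : (c + a) ^ 2 + b ^ 2 ≤ 1) {v y : E} (hv : ‖v‖ = 1) (hy : ‖y‖ ≤ 1) :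
    ‖c • v + spheroidMap a b v y‖ ≤ 1 := by
  have inner_vy := abs_le.1 (((abs_real_inner_le_norm v y).trans_eq (by rw [hv, one_mul])).trans hy)
  have inner_yy : ⟪y, y⟫ ≤ 1 := by
    rw [real_inner_self_eq_norm_sq]
    exact pow_le_one₀ (norm_nonneg _) hy
  have inner_vv : ⟪v, v⟫ = 1 := by rw [real_inner_self_eq_norm_sq, hv, one_pow]
  have norm_sq_eq : ‖c • v + spheroidMap a b v y‖ ^ 2 =
      (c + a * ⟪v, y⟫) ^ 2 + b ^ 2 * (⟪y, y⟫ - ⟪v, y⟫ ^ 2) := by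
    rw [← real_inner_self_eq_norm_sq, spheroidMap_apply a hb]
    simp only [inner_add_left, inner_add_right, real_inner_smul_left, real_inner_smul_right,
      inner_vv, real_inner_comm v y]
    ring
  have axial_le : (c + a * ⟪v, y⟫) ^ 2 ≤ (c + a) ^ 2 :=
    sq_le_sq' (by nlinarith) (by nlinarith)
  have transverse_le : b ^ 2 * (⟪y, y⟫ - ⟪v, y⟫ ^ 2) ≤ b ^ 2 * 1 := by
    gcongr
    nlinarith [sq_nonneg ⟪v, y⟫]
  rw [← sq_le_one_iff₀ (norm_nonneg _), norm_sq_eq]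
  linarith

theorem sub_le_inner_smul_add_spheroidMap {a b : ℝ} (ha : 0 ≤ a) (hb : b ≠ 0) (c : ℝ) {v y : E}
    (hv : ‖v‖ = 1) (hy : ‖y‖ ≤ 1) : c - a ≤ ⟪v, c • v + spheroidMap a b v y⟫ := by
  have inner_vy := abs_le.1 (((abs_real_inner_le_norm v y).trans_eq (by rw [hv, one_mul])).trans hy)
  rw [spheroidMap_apply a hb]
  simp only [inner_add_right, real_inner_smul_right, real_inner_self_eq_norm_sq, hv]
  nlinarith

variable [FiniteDimensional ℝ E] [Fintype ι]

theorem card_mul_le_of_inner_le {v : ι → E} {s a b c : ℝ} (hv : ∀ i, ‖v i‖ = 1)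
    (hvs : ∀ i j, i ≠ j → ⟪v i, v j⟫ ≤ s) (hs : s ≤ 1) (ha : 0 ≤ a) (hb : 0 < b) (hac : a ≤ c)
    (habc : (c + a) ^ 2 + b ^ 2 ≤ 1) (hst : s < (c - a) ^ 2) :
    Fintype.card ι * (b ^ Module.finrank ℝ E * (a / b)) ≤ (1 - s) / ((c - a) ^ 2 - s) := by
  let _ : MeasurableSpace E := borel E
  have : BorelSpace E := ⟨rfl⟩
  let ball : Set E := Metric.closedBall 0 1
  let spheroid (i : ι) : Set E := (fun y => c • v i + y) '' (spheroidMap a b (v i) '' ball)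
  have volume_spheroid (i : ι) : volume (spheroid i) =
      ENNReal.ofReal (b ^ Module.finrank ℝ E * (a / b)) * volume ball := by
    simp only [spheroid]
    rw [Set.image_add_left, measure_preimage_add, Measure.addHaar_image_linearMap,
      det_spheroidMap a hb.ne' (hv i), abs_of_nonneg (by positivity)]
  have measurable_spheroid (i : ι) : MeasurableSet (spheroid i) := by
    have hcont : Continuous (spheroidMap a b (v i)) := LinearMap.continuous_of_finiteDimensional _
    exact (((isCompact_closedBall 0 1).image hcont).image (by fun_prop)).measurableSet
  have spheroid_subset (i : ι) : spheroid i ⊆ ball := by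
    rintro _ ⟨_, ⟨y, hy, rfl⟩, rfl⟩
    exact mem_closedBall_zero_iff.2 (norm_smul_add_spheroidMap_le_one ha hb.ne' (ha.trans hac) habc
      (hv i) (mem_closedBall_zero_iff.1 hy))
  have volume_sum_le : ∑ i, volume (spheroid i) ≤
      ENNReal.ofReal ((1 - s) / ((c - a) ^ 2 - s)) * volume ball := by
    refine sum_measure_le_of_card_mem_le volume measurable_spheroid
      Metric.isClosed_closedBall.measurableSet spheroid_subset fun x hx I hI => ?_
    rw [← ENNReal.ofReal_natCast]
    refine ENNReal.ofReal_le_ofReal ((le_div_iff₀ (sub_pos.2 hst)).2 ?_)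
    refine card_mul_le_of_le_inner hv hvs hs (sub_nonneg.2 hac) (mem_closedBall_zero_iff.1 hx)
      fun i hi => ?_
    obtain ⟨_, ⟨y, hy, rfl⟩, rfl⟩ := hI i hi
    exact sub_le_inner_smul_add_spheroidMap ha hb.ne' c (hv i) (mem_closedBall_zero_iff.1 hy)
  have volume_ball_pos : volume ball ≠ 0 := (Metric.measure_closedBall_pos volume 0 one_pos).ne'
  have volume_ball_lt_top : volume ball ≠ ⊤ := (isCompact_closedBall 0 1).measure_lt_top.ne
  simp_rw [volume_spheroid, Finset.sum_const, Finset.card_univ, nsmul_eq_mul, ← mul_assoc]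
    at volume_sum_le
  rw [ENNReal.mul_le_mul_iff_left volume_ball_pos volume_ball_lt_top, ← ENNReal.ofReal_natCast,
    ← ENNReal.ofReal_mul (by positivity)] at volume_sum_le
  exact (ENNReal.ofReal_le_ofReal_iff
    (div_nonneg (sub_nonneg.2 hs) (sub_pos.2 hst).le)).1 volume_sum_le

end SphericalCode

theorem exists_card_le_of_inner_le.{u, w} {b s : ℝ} (hb : 0 < b) (hs : 0 ≤ s)
    (hbs : b ^ 2 + s < 1) :
    ∃ C : ℝ, 0 ≤ C ∧ ∀ {E : Type u} {ι : Type w} [NormedAddCommGroup E] [InnerProductSpace ℝ E]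
      [FiniteDimensional ℝ E] [Fintype ι] (v : ι → E), (∀ i, ‖v i‖ = 1) →
      (∀ i j, i ≠ j → inner ℝ (v i) (v j) ≤ s) →
      (Fintype.card ι : ℝ) ≤ C * b⁻¹ ^ Module.finrank ℝ E := by
  have hs1 : s ≤ 1 := by nlinarith
  have sqrt_lt : √s < √(1 - b ^ 2) := Real.sqrt_lt_sqrt hs (by linarith)
  obtain ⟨t, hst, htb⟩ := exists_between sqrt_lt
  have ht : 0 < t := (Real.sqrt_nonneg s).trans_lt hst
  -- `c - a` and `c + a` are the least and the greatest height of the spheroid along `v`.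
  obtain ⟨a, c, ha, hac, hsub, hadd⟩ :
      ∃ a c : ℝ, 0 < a ∧ a ≤ c ∧ c - a = t ∧ c + a = √(1 - b ^ 2) :=
    ⟨(√(1 - b ^ 2) - t) / 2, (√(1 - b ^ 2) + t) / 2, by linarith, by linarith, by ring, by ring⟩
  have habc : (c + a) ^ 2 + b ^ 2 ≤ 1 := by
    rw [hadd, Real.sq_sqrt (by linarith)]
    linarith
  have hst2 : s < (c - a) ^ 2 := hsub ▸ Real.lt_sq_of_sqrt_lt hst
  refine ⟨(1 - s) / ((c - a) ^ 2 - s) / (a / b),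
    div_nonneg (div_nonneg (sub_nonneg.2 hs1) (sub_pos.2 hst2).le) (by positivity),
    fun v hv hvs => ?_⟩
  rw [inv_pow, ← div_eq_mul_inv, div_div, le_div_iff₀ (by positivity), mul_comm (a / b)]
  exact card_mul_le_of_inner_le hv hvs hs1 ha.le hb hac habc hst2

section BinaryCode

variable {V ι : Type*} [Fintype V]

theorem hammingDist_eq_sum_sq_sub {x y : V → ℝ} (hx : ∀ w, x w = 0 ∨ x w = 1)
    (hy : ∀ w, y w = 0 ∨ y w = 1) : (hammingDist x y : ℝ) = ∑ w, (x w - y w) ^ 2 := by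
  rw [hammingDist, ← Finset.sum_boole]
  refine Finset.sum_congr rfl fun w _ => ?_
  rcases hx w with h | h <;> rcases hy w with h' | h' <;> simp [h, h']

/-- The vector of signs `(-1) ^ x w`, scaled to be a unit vector when `x` takes values in
`{0, 1}`. -/
noncomputable def signVector (x : V → ℝ) : EuclideanSpace ℝ V :=
  (√(Fintype.card V))⁻¹ • WithLp.toLp 2 (1 - (2 : ℝ) • x)

theorem inner_signVector [Nonempty V] {x y : V → ℝ} (hx : ∀ w, x w = 0 ∨ x w = 1)
    (hy : ∀ w, y w = 0 ∨ y w = 1) :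
    inner ℝ (signVector x) (signVector y) = 1 - 2 * (hammingDist x y / Fintype.card V) := by
  have card_pos : (0 : ℝ) < Fintype.card V := Nat.cast_pos.2 Fintype.card_pos
  have sign_mul_sign (w : V) : signVector y w * signVector x w =
      (Fintype.card V : ℝ)⁻¹ * (1 - 2 * (x w - y w) ^ 2) := by
    have coord (z : V → ℝ) : signVector z w = (√(Fintype.card V))⁻¹ * (1 - 2 * z w) := rfl
    rw [coord, coord, mul_mul_mul_comm, ← mul_inv, Real.mul_self_sqrt card_pos.le]
    rcases hx w with h | h <;> rcases hy w with h' | h' <;> norm_num [h, h']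
  simp only [PiLp.inner_apply, RCLike.inner_apply, conj_trivial, sign_mul_sign, ← Finset.mul_sum,
    Finset.sum_sub_distrib, ← hammingDist_eq_sum_sq_sub hx hy, Finset.sum_const, Finset.card_univ,
    nsmul_eq_mul, mul_one]
  field_simp

theorem finrank_span_range_signVector_le {a : ι → V → ℝ} {R : Submodule ℝ (V → ℝ)}
    (hR : ∀ i, a i ∈ R) :
    Module.finrank ℝ (Submodule.span ℝ (Set.range fun i => signVector (a i))) ≤
      Module.finrank ℝ R + 1 := by
  let e := (WithLp.linearEquiv 2 ℝ (V → ℝ)).symm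
  let F : Submodule ℝ (V → ℝ) := R ⊔ Submodule.span ℝ {1}
  have span_le : Submodule.span ℝ (Set.range fun i => signVector (a i)) ≤
      F.map e.toLinearMap := by
    rw [Submodule.span_le]
    rintro _ ⟨i, rfl⟩
    refine Submodule.smul_mem _ _ (Submodule.mem_map_of_mem (F.sub_mem ?_ (F.smul_mem _ ?_)))
    · exact Submodule.mem_sup_right (Submodule.mem_span_singleton_self _)
    · exact Submodule.mem_sup_left (hR i)
  calc Module.finrank ℝ (Submodule.span ℝ (Set.range fun i => signVector (a i)))
      ≤ Module.finrank ℝ F := (Submodule.finrank_mono span_le).trans_eq (e.finrank_map_eq F)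
    _ ≤ Module.finrank ℝ R + Module.finrank ℝ (Submodule.span ℝ {(1 : V → ℝ)}) :=
        Submodule.finrank_add_le_finrank_add_finrank _ _
    _ ≤ Module.finrank ℝ R + 1 := by
        gcongr
        exact (finrank_span_le_card _).trans (by simp)

theorem exists_card_le_of_le_hammingDist.{u, w} {b δ : ℝ} (hb : 0 < b) (hδ : δ ≤ 1 / 2)
    (hbδ : b ^ 2 < 2 * δ) :
    ∃ C : ℝ, 0 ≤ C ∧ ∀ {V : Type u} {ι : Type w} [Fintype V] [Nonempty V] [Fintype ι]
      (a : ι → V → ℝ) (R : Submodule ℝ (V → ℝ)), (∀ i w, a i w = 0 ∨ a i w = 1) →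
      (∀ i, a i ∈ R) → (∀ i j, i ≠ j → δ * Fintype.card V ≤ hammingDist (a i) (a j)) →
      (Fintype.card ι : ℝ) ≤ C * b⁻¹ ^ Module.finrank ℝ R := by
  obtain ⟨C, hC, card_le⟩ :=
    exists_card_le_of_inner_le.{u, w} (s := 1 - 2 * δ) hb (by linarith) (by linarith)
  refine ⟨C * b⁻¹, by positivity, fun {V ι} _ _ _ a R h01 hR hdist => ?_⟩
  let E := Submodule.span ℝ (Set.range fun i => signVector (a i))
  let v (i : ι) : E := ⟨signVector (a i), Submodule.subset_span ⟨i, rfl⟩⟩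
  have norm_v (i : ι) : ‖v i‖ = 1 := by
    rw [← sq_eq_sq₀ (norm_nonneg _) zero_le_one, ← real_inner_self_eq_norm_sq, Submodule.coe_inner,
      inner_signVector (h01 i) (h01 i), hammingDist_self]
    simp
  have inner_v (i j : ι) (hij : i ≠ j) : inner ℝ (v i) (v j) ≤ 1 - 2 * δ := by
    rw [Submodule.coe_inner, inner_signVector (h01 i) (h01 j)]
    linarith [(le_div_iff₀ (Nat.cast_pos.2 Fintype.card_pos)).2 (hdist i j hij)]
  have one_le_inv : 1 ≤ b⁻¹ := (one_le_inv₀ hb).2 (by nlinarith)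
  calc (Fintype.card ι : ℝ) ≤ C * b⁻¹ ^ Module.finrank ℝ E := card_le v norm_v inner_v
    _ ≤ C * b⁻¹ ^ (Module.finrank ℝ R + 1) := by
        gcongr
        exact finrank_span_range_signVector_le hR
    _ = C * b⁻¹ * b⁻¹ ^ Module.finrank ℝ R := by ring

theorem sum_sum_sq_sub_le {M : Finset ι} {a : ι → ℝ} (ha : ∀ i ∈ M, a i ∈ Set.Icc 0 1) :
    ∑ i ∈ M, ∑ j ∈ M, (a i - a j) ^ 2 ≤ (M.card : ℝ) ^ 2 / 2 := by
  have expand : ∑ i ∈ M, ∑ j ∈ M, (a i - a j) ^ 2 =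
      2 * M.card * ∑ i ∈ M, a i ^ 2 - 2 * (∑ i ∈ M, a i) ^ 2 := by
    simp only [sub_sq, Finset.sum_add_distrib, Finset.sum_sub_distrib, Finset.sum_const,
      nsmul_eq_mul, ← Finset.mul_sum, ← Finset.sum_mul]
    ring
  have sum_sq_le : ∑ i ∈ M, a i ^ 2 ≤ ∑ i ∈ M, a i :=
    Finset.sum_le_sum fun i hi => pow_le_of_le_one (ha i hi).1 (ha i hi).2 two_ne_zero
  rw [expand]
  nlinarith [sq_nonneg ((M.card : ℝ) - 2 * ∑ i ∈ M, a i), M.card.cast_nonneg (α := ℝ)]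

theorem card_mul_mul_sub_one_le_sum_sum {M : Finset ι} {f : ι → ι → ℝ} {d : ℝ}
    (hdiag : ∀ i ∈ M, 0 ≤ f i i) (hd : ∀ i ∈ M, ∀ j ∈ M, i ≠ j → d ≤ f i j) :
    M.card * (d * (M.card - 1)) ≤ ∑ i ∈ M, ∑ j ∈ M, f i j := by
  classical
  rw [← nsmul_eq_mul]
  refine Finset.card_nsmul_le_sum _ _ _ fun i hi => ?_
  calc d * (M.card - 1) = ∑ j ∈ M, (d - if i = j then d else 0) := by
        rw [Finset.sum_sub_distrib, Finset.sum_ite_eq, if_pos hi, Finset.sum_const, nsmul_eq_mul]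
        ring
    _ ≤ ∑ j ∈ M, f i j := by
        refine Finset.sum_le_sum fun j hj => ?_
        split_ifs with hij
        · rw [sub_self, ← hij]
          exact hdiag i hi
        · rw [sub_zero]
          exact hd i hi j hj hij

theorem plotkin_bound {a : ι → V → ℝ} (h01 : ∀ i w, a i w = 0 ∨ a i w = 1) {M : Finset ι}
    {L : Finset V} {d : ℕ} (hd : ∀ i ∈ M, ∀ j ∈ M, i ≠ j → d ≤ hammingDist (a i) (a j))
    (hL : ∀ i ∈ M, ∀ j ∈ M, ∀ w ∉ L, a i w = a j w) :
    2 * d * ((M.card : ℝ) - 1) ≤ L.card * M.card := by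
  rcases M.eq_empty_or_nonempty with rfl | hM
  · simp
  have dist_eq {i j : ι} (hi : i ∈ M) (hj : j ∈ M) :
      (hammingDist (a i) (a j) : ℝ) = ∑ w ∈ L, (a i w - a j w) ^ 2 := by
    rw [hammingDist_eq_sum_sq_sub (h01 i) (h01 j)]
    refine (Finset.sum_subset L.subset_univ fun w _ hw => ?_).symm
    simp [hL i hi j hj w hw]
  have lower : (M.card : ℝ) * (d * (M.card - 1)) ≤
      ∑ i ∈ M, ∑ j ∈ M, (hammingDist (a i) (a j) : ℝ) :=
    card_mul_mul_sub_one_le_sum_sum (fun _ _ => Nat.cast_nonneg _) fun i hi j hj hij =>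
      Nat.cast_le.2 (hd i hi j hj hij)
  have upper : ∑ i ∈ M, ∑ j ∈ M, (hammingDist (a i) (a j) : ℝ) ≤
      L.card * ((M.card : ℝ) ^ 2 / 2) := by
    calc ∑ i ∈ M, ∑ j ∈ M, (hammingDist (a i) (a j) : ℝ)
        = ∑ i ∈ M, ∑ j ∈ M, ∑ w ∈ L, (a i w - a j w) ^ 2 :=
          Finset.sum_congr rfl fun i hi => Finset.sum_congr rfl fun j hj => dist_eq hi hj
      _ = ∑ w ∈ L, ∑ i ∈ M, ∑ j ∈ M, (a i w - a j w) ^ 2 :=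
          (Finset.sum_congr rfl fun i _ => Finset.sum_comm).trans Finset.sum_comm
      _ ≤ L.card * ((M.card : ℝ) ^ 2 / 2) := by
          rw [← nsmul_eq_mul]
          refine Finset.sum_le_card_nsmul _ _ _ fun w _ => sum_sum_sq_sub_le fun i _ => ?_
          rcases h01 i w with h | h <;> simp [h]
  have card_pos : (0 : ℝ) < M.card := Nat.cast_pos.2 hM.card_pos
  refine le_of_mul_le_mul_left ?_ card_pos
  linarith

end BinaryCode

/-! ### Rank and vectors of minimal weight -/

section MinimalWeight

variable {V K : Type*} [Fintype V] [Field K] [DecidableEq K]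

/-- A nonzero vector whose Hamming weight is least possible in the code `R`. -/
structure IsMinWeight (R : Submodule K (V → K)) (x : V → K) : Prop where
  mem : x ∈ R
  ne_zero : x ≠ 0
  hammingNorm_le : ∀ z ∈ R, z ≠ 0 → hammingNorm x ≤ hammingNorm z

theorem exists_isMinWeight {R : Submodule K (V → K)} (hR : R ≠ ⊥) : ∃ x, IsMinWeight R x := by
  obtain ⟨z, hz⟩ := R.exists_mem_ne_zero_of_ne_bot hR
  obtain ⟨x, ⟨hxR, hx0⟩, hmin⟩ :=
    exists_minimalFor_of_wellFoundedLT (fun z => z ∈ R ∧ z ≠ 0) hammingNorm ⟨z, hz⟩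
  exact ⟨x, hxR, hx0, fun z hz hz0 => (le_total _ _).elim id (hmin ⟨hz, hz0⟩)⟩

namespace IsMinWeight

variable {R : Submodule K (V → K)} {x y : V → K}

theorem hammingNorm_le_hammingDist (hx : IsMinWeight R x) {z z' : V → K} (hz : z ∈ R)
    (hz' : z' ∈ R) (hne : z ≠ z') : hammingNorm x ≤ hammingDist z z' := by
  rw [hammingDist_comm, hammingDist_eq_hammingNorm, neg_add_eq_sub]
  exact hx.hammingNorm_le _ (R.sub_mem hz hz') (sub_ne_zero.2 hne)

theorem of_support_subset (hx : IsMinWeight R x) (hy : y ∈ R) (hy0 : y ≠ 0)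
    (hsupp : ∀ w, x w = 0 → y w = 0) : IsMinWeight R y where
  mem := hy
  ne_zero := hy0
  hammingNorm_le z hz hz0 :=
    (Finset.card_le_card (Finset.monotone_filter_right _ fun w _ => mt (hsupp w))).trans
      (hx.hammingNorm_le z hz hz0)

theorem exists_eq_smul (hx : IsMinWeight R x) (hy : y ∈ R) (hsupp : ∀ w, x w = 0 → y w = 0) :
    ∃ c : K, y = c • x := by
  obtain ⟨s, hs⟩ : ∃ s, x s ≠ 0 := Function.ne_iff.1 hx.ne_zero
  refine ⟨y s / x s, ?_⟩
  by_contra hne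
  refine (hx.hammingNorm_le _ (R.sub_mem hy (R.smul_mem _ hx.mem)) (sub_ne_zero.2 hne)).not_gt
    (Finset.card_lt_card ?_)
  rw [Finset.ssubset_iff_of_subset
    (Finset.monotone_filter_right _ fun w _ => mt fun hw => by simp [hw, hsupp w hw])]
  exact ⟨s, by simpa using hs, by simp [hs]⟩

end IsMinWeight

theorem card_zeros_add_hammingNorm (x : V → K) [Fintype {w // x w = 0}] :
    Fintype.card {w // x w = 0} + hammingNorm x = Fintype.card V := by
  classical
  rw [Fintype.card_subtype, hammingNorm, Finset.card_filter_add_card_filter_not, Finset.card_univ]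

end MinimalWeight

section Rank

variable {K l m n : Type*} [Field K]

theorem rank_submatrix_add_one_le [Fintype n] (M : Matrix m n K) (f : l → m) {x : m → K}
    (hx : x ∈ LinearMap.range M.mulVecLin) (hx0 : x ≠ 0)
    (hxf : ∀ u, x (f u) = 0) : (M.submatrix f id).rank + 1 ≤ M.rank := by
  let restrict := (LinearMap.funLeft K K f).domRestrict (LinearMap.range M.mulVecLin)
  have range_eq : LinearMap.range (M.submatrix f id).mulVecLin = LinearMap.range restrict := by
    rw [LinearMap.range_domRestrict, ← LinearMap.range_comp]
    congr 1
  have ker_ne_bot : LinearMap.ker restrict ≠ ⊥ :=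
    (Submodule.ne_bot_iff _).2 ⟨⟨x, hx⟩, funext hxf, fun h => hx0 (congrArg Subtype.val h)⟩
  have : Nontrivial (LinearMap.ker restrict) := Submodule.nontrivial_iff_ne_bot.2 ker_ne_bot
  have ker_pos : 0 < Module.finrank K (LinearMap.ker restrict) :=
    Module.finrank_pos (R := K) (M := LinearMap.ker restrict)
  have := LinearMap.finrank_range_add_finrank_ker restrict
  rw [Matrix.rank, Matrix.rank, range_eq]
  lia

variable [Fintype m] {A : Matrix m m K}

theorem row_mem_range_mulVecLin (hA : A.IsSymm) (v : m) : A v ∈ LinearMap.range A.mulVecLin := by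
  classical exact ⟨Pi.single v 1, by ext w; simp [hA.apply]⟩

theorem row_sub_row_mem_range_mulVecLin (hA : A.IsSymm) (u v : m) :
    A u - A v ∈ LinearMap.range A.mulVecLin :=
  Submodule.sub_mem _ (row_mem_range_mulVecLin hA u) (row_mem_range_mulVecLin hA v)

theorem rank_submatrix_zeros_add_one_le [DecidableEq K] (hA : A.IsSymm) {x : m → K}
    (hx : x ∈ LinearMap.range A.mulVecLin) (hx0 : x ≠ 0) :
    (A.submatrix id (Subtype.val : {w // x w = 0} → m)).rank + 1 ≤ A.rank := by
  have h := rank_submatrix_add_one_le A (Subtype.val : {w // x w = 0} → m) hx hx0 Subtype.prop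
  rwa [← Matrix.rank_transpose, Matrix.transpose_submatrix, hA.eq] at h

theorem rank_toSquareBlockProp_zeros_add_one_le [DecidableEq K] (hA : A.IsSymm) {x : m → K}
    (hx : x ∈ LinearMap.range A.mulVecLin) (hx0 : x ≠ 0) :
    (A.toSquareBlockProp fun w => x w = 0).rank + 1 ≤ A.rank :=
  (Nat.succ_le_succ (Matrix.rank_submatrix_le (A.submatrix id Subtype.val) Subtype.val id)).trans
    (rank_submatrix_zeros_add_one_le hA hx hx0)

theorem rank_toSquareBlockProp_zeros_add_two_le [DecidableEq K] (hA : A.IsSymm) {u v : m}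
    {x : m → K} (hx : x = A u - A v) (hx0 : x ≠ 0) (hu : x u = 0) (hv : x v = 0) :
    (A.toSquareBlockProp fun w => x w = 0).rank + 2 ≤ A.rank := by
  classical
  have mem_range : x ∈ LinearMap.range
      (A.submatrix id (Subtype.val : {w // x w = 0} → m)).mulVecLin :=
    ⟨Pi.single ⟨u, hu⟩ 1 - Pi.single ⟨v, hv⟩ 1, by
      ext w; simp [Matrix.mulVec_sub, hx, hA.apply]⟩
  have rows := rank_submatrix_add_one_le (A.submatrix id Subtype.val)
    (Subtype.val : {w // x w = 0} → m) mem_range hx0 Subtype.prop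
  have columns :=
    rank_submatrix_zeros_add_one_le hA (hx ▸ row_sub_row_mem_range_mulVecLin hA u v) hx0
  exact (Nat.succ_le_succ rows).trans columns

end Rank

theorem exists_injective_submatrix {V α : Type*} [Finite V] {A : Matrix V V α} (hA : A.IsSymm) :
    ∃ s : Set V, s.ncard = (Set.range A).ncard ∧
      Function.Injective (A.submatrix (Subtype.val : s → V) (Subtype.val : s → V)) := by
  obtain ⟨s, -, hs⟩ := (Set.surjOn_image (fun v => A v) Set.univ).exists_bijOn_subset
  rw [Set.image_univ] at hs
  refine ⟨s, by rw [← hs.image_eq, hs.injOn.ncard_image], fun p q hpq =>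
    Subtype.ext (hs.injOn p.2 q.2 (funext fun w => ?_))⟩
  obtain ⟨u, hu, huw⟩ := hs.surjOn (Set.mem_range_self w)
  have column_eq (v : V) : A v w = A v u := by rw [← hA.apply, ← huw, hA.apply]
  rw [column_eq, column_eq]
  exact congrFun hpq ⟨u, hu⟩

section Counting

variable {α β : Type*} [Fintype α]

open scoped Classical in
/-- The points which are alone in their fibre of `f`. -/
noncomputable def loners (f : α → β) : Finset α :=
  Finset.univ.filter fun a => ∀ b, f b = f a → b = a

theorem card_add_card_loners_le {f : α → β}
    (hf : ∀ a b c, f a = f b → f a = f c → a = b ∨ a = c ∨ b = c) :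
    Fintype.card α + (loners f).card ≤ 2 * (Set.range f).ncard := by
  classical
  have fibre_le (y : β) : (Finset.univ.filter fun a => f a = y).card +
      ((loners f).filter fun a => f a = y).card ≤ 2 := by
    rcases ((loners f).filter fun a => f a = y).eq_empty_or_nonempty with hy | ⟨z, hz⟩
    · rw [hy, Finset.card_empty, add_zero]
      by_contra! hcon
      obtain ⟨a, b, c, ha, hb, hc, hab, hac, hbc⟩ := Finset.two_lt_card_iff.1 hcon
      simp only [Finset.mem_filter, Finset.mem_univ, true_and] at ha hb hc
      exact (hf a b c (ha.trans hb.symm) (ha.trans hc.symm)).elim hab fun h => h.elim hac hbc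
    · simp only [loners, Finset.mem_filter, Finset.mem_univ, true_and] at hz
      have fibre_subset : (Finset.univ.filter fun a => f a = y) ⊆ {z} := fun a ha =>
        Finset.mem_singleton.2 (hz.1 a ((Finset.mem_filter.1 ha).2.trans hz.2.symm))
      have fibre_card := Finset.card_le_card fibre_subset
      have loners_card := Finset.card_le_card
        ((Finset.filter_subset_filter _ (loners f).subset_univ).trans fibre_subset)
      simp only [Finset.card_singleton] at fibre_card loners_card
      lia
  have maps_to (s : Finset α) : ∀ a ∈ s, f a ∈ Finset.univ.image f := fun a _ =>
    Finset.mem_image_of_mem f (Finset.mem_univ a)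
  rw [← Set.image_univ, ← Finset.coe_univ, ← Finset.coe_image, Set.ncard_coe_finset,
    ← Finset.card_univ, Finset.card_eq_sum_card_fiberwise (maps_to Finset.univ),
    Finset.card_eq_sum_card_fiberwise (maps_to (loners f)), ← Finset.sum_add_distrib, mul_comm,
    ← smul_eq_mul]
  exact Finset.sum_le_card_nsmul _ _ _ fun y _ => fibre_le y

end Counting

section MinimalDifference

variable {V : Type*} [Fintype V]

theorem IsMinWeight.sub_eq_or_eq_neg {R : Submodule ℝ (V → ℝ)} {y : V → ℝ} (hmin : IsMinWeight R y)
    (hy : ∀ w, y w = 0 ∨ y w = 1 ∨ y w = -1) {a b : V → ℝ} (ha : ∀ w, a w = 0 ∨ a w = 1)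
    (hb : ∀ w, b w = 0 ∨ b w = 1) (hab : a - b ∈ R) (hne : a ≠ b)
    (hagree : ∀ w, y w = 0 → a w = b w) : a - b = y ∨ a - b = -y := by
  obtain ⟨c, hc⟩ := hmin.exists_eq_smul hab fun w hw => sub_eq_zero.2 (hagree w hw)
  obtain ⟨s, hs⟩ : ∃ s, y s ≠ 0 := Function.ne_iff.1 hmin.ne_zero
  have c_ne_zero : c ≠ 0 := by
    rintro rfl
    exact hne (sub_eq_zero.1 (hc.trans (zero_smul ℝ y)))
  have at_s : a s - b s = c * y s := congrFun hc s
  have c_eq : c = 1 ∨ c = -1 := by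
    have := (hy s).resolve_left hs
    grind
  rcases c_eq with rfl | rfl
  · exact Or.inl (hc.trans (one_smul ℝ y))
  · exact Or.inr (hc.trans (neg_one_smul ℝ y))

variable {A : Matrix V V ℝ} (hA : A.IsSymm) (h01 : ∀ i j, A i j = 0 ∨ A i j = 1)
  (hinj : Function.Injective A) {y : V → ℝ} (hy : ∀ w, y w = 0 ∨ y w = 1 ∨ y w = -1)
  (hmin : IsMinWeight (LinearMap.range A.mulVecLin) y)

include hA h01 hinj hy hmin

theorem row_sub_row_eq_or_eq_neg {u v : V} (huv : u ≠ v) (hagree : ∀ w, y w = 0 → A u w = A v w) :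
    A u - A v = y ∨ A u - A v = -y :=
  hmin.sub_eq_or_eq_neg hy (h01 u) (h01 v) (row_sub_row_mem_range_mulVecLin hA u v)
    (hinj.ne huv) hagree

theorem eq_or_eq_or_eq_of_row_eq_on_zeros {a b c : V} (hab : ∀ w, y w = 0 → A a w = A b w)
    (hac : ∀ w, y w = 0 → A a w = A c w) : a = b ∨ a = c ∨ b = c := by
  by_contra! hne
  obtain ⟨s, hs⟩ : ∃ s, y s ≠ 0 := Function.ne_iff.1 hmin.ne_zero
  have hbc (w : V) (hw : y w = 0) : A b w = A c w := (hab w hw).symm.trans (hac w hw)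
  have difference {u v : V} (huv : u ≠ v) (hagree : ∀ w, y w = 0 → A u w = A v w) :
      A u s - A v s = y s ∨ A u s - A v s = -y s :=
    (row_sub_row_eq_or_eq_neg hA h01 hinj hy hmin huv hagree).imp (congrFun · s) (congrFun · s)
  have := difference hne.1 hab
  have := difference hne.2.1 hac
  have := difference hne.2.2 hbc
  grind

theorem apply_eq_apply_of_row_eq_on_zeros {u v s s' : V} (huv : u ≠ v)
    (hagree : ∀ w, y w = 0 → A u w = A v w) (hs : y s ≠ 0) (hss' : y s = y s') :
    A u s = A u s' := by
  have difference : A u s - A v s = A u s' - A v s' ∧ A u s - A v s ≠ 0 := by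
    rcases row_sub_row_eq_or_eq_neg hA h01 hinj hy hmin huv hagree with h | h
    all_goals
      have at_s := congrFun h s
      have at_s' := congrFun h s'
      simp only [Pi.sub_apply, Pi.neg_apply] at at_s at_s'
      grind
  have := h01 u s
  have := h01 u s'
  have := h01 v s
  have := h01 v s'
  grind

theorem two_mul_hammingNorm_mul_le {σ : ℝ} (hσ : σ ≠ 0) :
    2 * hammingNorm y * (((Finset.univ.filter fun s => y s = σ).card : ℝ) - 1) ≤
      (hammingNorm y + (loners (A.toSquareBlockProp fun w => y w = 0)).card) *
        (Finset.univ.filter fun s => y s = σ).card := by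
  classical
  let Z := (loners (A.toSquareBlockProp fun w => y w = 0)).map (Function.Embedding.subtype _)
  let L := (Finset.univ.filter fun w => y w ≠ 0) ∪ Z
  have columns_const (s s' w : V) (hs : y s = σ) (hs' : y s' = σ) (hw : w ∉ L) :
      A s w = A s' w := by
    simp only [L, Z, Finset.mem_union, Finset.mem_filter, Finset.mem_univ, true_and, not_or,
      not_not, Finset.mem_map, not_exists, not_and] at hw
    obtain ⟨v, hv, hne⟩ : ∃ v : {w // y w = 0}, A.toSquareBlockProp (fun w => y w = 0) v =
        A.toSquareBlockProp (fun w => y w = 0) ⟨w, hw.1⟩ ∧ v ≠ ⟨w, hw.1⟩ := by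
      simpa [loners] using hw.2 ⟨w, hw.1⟩
    rw [← hA.apply s w, ← hA.apply s' w]
    exact apply_eq_apply_of_row_eq_on_zeros hA h01 hinj hy hmin (fun h => hne (Subtype.ext h.symm))
      (fun t ht => (congrFun hv ⟨t, ht⟩).symm) (hs.trans_ne hσ) (hs.trans hs'.symm)
  have card_L : (L.card : ℝ) ≤
      hammingNorm y + (loners (A.toSquareBlockProp fun w => y w = 0)).card := by
    rw [← Finset.card_map (Function.Embedding.subtype _)]
    exact mod_cast Finset.card_union_le _ _
  refine (plotkin_bound h01 (L := L) (fun i _ j _ hij => ?_) fun i hi j hj w hw => ?_).trans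
    (by gcongr)
  · exact hmin.hammingNorm_le_hammingDist (row_mem_range_mulVecLin hA i)
      (row_mem_range_mulVecLin hA j) (hinj.ne hij)
  · exact columns_const i j w (Finset.mem_filter.1 hi).2 (Finset.mem_filter.1 hj).2 hw

theorem hammingNorm_le_card_loners_add_four :
    hammingNorm y ≤ (loners (A.toSquareBlockProp fun w => y w = 0)).card + 4 := by
  classical
  have card_support : (((Finset.univ.filter fun s => y s = 1).card : ℝ) +
      (Finset.univ.filter fun s => y s = -1).card) = hammingNorm y := by
    rw [← Nat.cast_add, ← Finset.card_union_of_disjoint (Finset.disjoint_filter.2 (by grind)),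
      ← Finset.filter_or, hammingNorm]
    congr 2
    grind
  have positive := two_mul_hammingNorm_mul_le hA h01 hinj hy hmin one_ne_zero
  have negative := two_mul_hammingNorm_mul_le hA h01 hinj hy hmin (neg_ne_zero.2 one_ne_zero)
  have norm_pos : (0 : ℝ) < hammingNorm y := Nat.cast_pos.2 (hammingNorm_pos_iff.2 hmin.ne_zero)
  have : (hammingNorm y : ℝ) ≤ (loners (A.toSquareBlockProp fun w => y w = 0)).card + 4 := by
    refine le_of_mul_le_mul_left ?_ norm_pos
    nlinarith
  exact_mod_cast this

theorem card_le_two_mul_ncard_range_add_four :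
    Fintype.card V ≤ 2 * (Set.range (A.toSquareBlockProp fun w => y w = 0)).ncard + 4 := by
  have card_zeros := card_zeros_add_hammingNorm y
  have norm_le := hammingNorm_le_card_loners_add_four hA h01 hinj hy hmin
  have loners_le : Fintype.card {w // y w = 0} +
      (loners (A.toSquareBlockProp fun w => y w = 0)).card ≤
      2 * (Set.range (A.toSquareBlockProp fun w => y w = 0)).ncard :=
    card_add_card_loners_le fun a b c hab hac => by
      simpa only [Subtype.ext_iff] using eq_or_eq_or_eq_of_row_eq_on_zeros hA h01 hinj hy hmin
        (fun w hw => congrFun hab ⟨w, hw⟩) fun w hw => congrFun hac ⟨w, hw⟩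
  lia

end MinimalDifference

/-! ### The number of distinct rows of a 0-1 matrix of given rank -/

section RowBound

variable {V : Type*} [Fintype V] {A : Matrix V V ℝ}

theorem card_le_of_hammingNorm_le {K : ℝ} (hK : 0 ≤ K) (hA : A.IsSymm) {x : V → ℝ}
    (hx : IsMinWeight (LinearMap.range A.mulVecLin) x)
    (hweight : √2 * hammingNorm x ≤ (√2 - 1) * Fintype.card V)
    (hblock : (Fintype.card {w // x w = 0} : ℝ) ≤
      K * √2 ^ (A.toSquareBlockProp fun w => x w = 0).rank - 4) :
    (Fintype.card V : ℝ) ≤ K * √2 ^ A.rank - 4 := by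
  have one_le_sqrt : (1 : ℝ) ≤ √2 := Real.one_le_sqrt.2 one_le_two
  have card_zeros : (Fintype.card {w // x w = 0} : ℝ) + hammingNorm x = Fintype.card V :=
    mod_cast card_zeros_add_hammingNorm x
  have pow_le : √2 ^ (A.toSquareBlockProp fun w => x w = 0).rank * √2 ≤ √2 ^ A.rank := by
    rw [← pow_succ]
    exact pow_le_pow_right₀ one_le_sqrt
      (rank_toSquareBlockProp_zeros_add_one_le hA hx.mem hx.ne_zero)
  calc (Fintype.card V : ℝ) ≤ √2 * Fintype.card {w // x w = 0} := by
        rw [← card_zeros] at hweight ⊢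
        linarith
    _ ≤ √2 * (K * √2 ^ (A.toSquareBlockProp fun w => x w = 0).rank - 4) := by gcongr
    _ ≤ K * (√2 ^ (A.toSquareBlockProp fun w => x w = 0).rank * √2) - 4 := by linarith
    _ ≤ K * √2 ^ A.rank - 4 := by gcongr

theorem card_le_of_row_eq_on_zeros {K : ℝ} (hK : 0 ≤ K) (hA : A.IsSymm)
    (h01 : ∀ i j, A i j = 0 ∨ A i j = 1) (hinj : Function.Injective A) {u v : V} {y : V → ℝ}
    (hyuv : y = A u - A v) (hy : IsMinWeight (LinearMap.range A.mulVecLin) y) (hu : y u = 0)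
    (hv : y v = 0)
    (hblock : ((Set.range (A.toSquareBlockProp fun w => y w = 0)).ncard : ℝ) ≤
      K * √2 ^ (A.toSquareBlockProp fun w => y w = 0).rank - 4) :
    (Fintype.card V : ℝ) ≤ K * √2 ^ A.rank - 4 := by
  have y_values (w : V) : y w = 0 ∨ y w = 1 ∨ y w = -1 := by
    have := h01 u w
    have := h01 v w
    have : y w = A u w - A v w := congrFun hyuv w
    grind
  have pow_le : √2 ^ (A.toSquareBlockProp fun w => y w = 0).rank * 2 ≤ √2 ^ A.rank := by
    have := pow_le_pow_right₀ (Real.one_le_sqrt.2 one_le_two)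
      (rank_toSquareBlockProp_zeros_add_two_le hA hyuv hy.ne_zero hu hv)
    rwa [pow_add, Real.sq_sqrt zero_le_two] at this
  calc (Fintype.card V : ℝ)
      ≤ 2 * (Set.range (A.toSquareBlockProp fun w => y w = 0)).ncard + 4 :=
        mod_cast card_le_two_mul_ncard_range_add_four hA h01 hinj y_values hy
    _ ≤ 2 * (K * √2 ^ (A.toSquareBlockProp fun w => y w = 0).rank - 4) + 4 := by gcongr
    _ = K * (√2 ^ (A.toSquareBlockProp fun w => y w = 0).rank * 2) - 4 := by ring
    _ ≤ K * √2 ^ A.rank - 4 := by gcongr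

theorem card_le_of_ncard_range_block_le {C : ℝ} (hC : 0 ≤ C) (hA : A.IsSymm)
    (h01 : ∀ i j, A i j = 0 ∨ A i j = 1) (hinj : Function.Injective A)
    (hcode : (∀ u v, u ≠ v → (√2 - 1) * Fintype.card V ≤ √2 * hammingDist (A u) (A v)) →
      (Fintype.card V : ℝ) ≤ C * √2 ^ A.rank)
    (hblock : ∀ x ∈ LinearMap.range A.mulVecLin, x ≠ 0 →
      ((Set.range (A.toSquareBlockProp fun w => x w = 0)).ncard : ℝ) ≤
        (C + 5) * √2 ^ (A.toSquareBlockProp fun w => x w = 0).rank - 4) :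
    (Fintype.card V : ℝ) ≤ (C + 5) * √2 ^ A.rank - 4 := by
  have one_le_pow : 1 ≤ √2 ^ A.rank := one_le_pow₀ (Real.one_le_sqrt.2 one_le_two)
  have mem_range := row_mem_range_mulVecLin hA
  by_cases hrange : LinearMap.range A.mulVecLin = ⊥
  · have row_eq_zero (v : V) : A v = 0 := by simpa [hrange] using mem_range v
    have : Subsingleton V := ⟨fun u v => hinj ((row_eq_zero u).trans (row_eq_zero v).symm)⟩
    have card_le_one : (Fintype.card V : ℝ) ≤ 1 :=
      mod_cast Fintype.card_le_one_iff_subsingleton.2 this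
    nlinarith
  obtain ⟨x, hx⟩ := exists_isMinWeight hrange
  rcases le_total ((√2 - 1) * Fintype.card V) (√2 * hammingNorm x) with far | near
  · have card_le := hcode fun u v huv => far.trans (by
      gcongr
      exact hx.hammingNorm_le_hammingDist (mem_range u) (mem_range v) (hinj.ne huv))
    linarith
  by_cases hrows : Function.Injective (A.toSquareBlockProp fun w => x w = 0)
  · refine card_le_of_hammingNorm_le (by positivity) hA hx near ?_
    rw [← Nat.card_eq_fintype_card, ← Nat.card_range_of_injective hrows, Nat.card_coe_set_eq]
    exact hblock x hx.mem hx.ne_zero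
  · obtain ⟨u, v, huv, hne⟩ := Function.not_injective_iff.1 hrows
    have row_ne : A u ≠ A v := fun h => hne (Subtype.ext (hinj h))
    have vanishes (w : V) (hw : x w = 0) : (A u - A v) w = 0 :=
      sub_eq_zero.2 (congrFun huv ⟨w, hw⟩)
    have min := hx.of_support_subset (row_sub_row_mem_range_mulVecLin hA u v)
      (sub_ne_zero.2 row_ne) vanishes
    exact card_le_of_row_eq_on_zeros (by positivity) hA h01 hinj rfl min (vanishes u u.2)
      (vanishes v v.2) (hblock _ min.mem min.ne_zero)

theorem exists_card_le_of_far_rows.{u} : ∃ C : ℝ, 0 ≤ C ∧ ∀ {V : Type u} [Fintype V]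
    {A : Matrix V V ℝ}, A.IsSymm → (∀ i j, A i j = 0 ∨ A i j = 1) →
    (∀ u v, u ≠ v → (√2 - 1) * Fintype.card V ≤ √2 * hammingDist (A u) (A v)) →
    (Fintype.card V : ℝ) ≤ C * √2 ^ A.rank := by
  have sqrt_pos : 0 < √2 := Real.sqrt_pos.2 two_pos
  have sqrt_sq : √2 ^ 2 = 2 := Real.sq_sqrt zero_le_two
  have sqrt_lt : √2 < 3 / 2 := (Real.sqrt_lt' (by norm_num)).2 (by norm_num)
  have relative_eq : (√2 - 1) / √2 = 1 - √2 / 2 := by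
    field_simp
    linarith
  obtain ⟨C, hC, card_le⟩ := exists_card_le_of_le_hammingDist.{u, u} (b := (√2)⁻¹)
    (δ := (√2 - 1) / √2) (by positivity) (by rw [relative_eq]; nlinarith)
    (by rw [relative_eq, inv_pow, sqrt_sq]; linarith)
  refine ⟨C, hC, fun {V} _ A hA h01 hfar => ?_⟩
  rcases isEmpty_or_nonempty V with _ | _
  · rw [Fintype.card_eq_zero, Nat.cast_zero]
    positivity
  rw [← inv_inv √2]
  refine card_le A (LinearMap.range A.mulVecLin) h01 (row_mem_range_mulVecLin hA) fun u v huv => ?_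
  rw [div_mul_eq_mul_div, div_le_iff₀' sqrt_pos]
  exact hfar u v huv

theorem exists_ncard_range_le.{u} : ∃ K : ℝ, 0 ≤ K ∧ ∀ {V : Type u} [Fintype V]
    {A : Matrix V V ℝ}, A.IsSymm → (∀ i j, A i j = 0 ∨ A i j = 1) →
    ((Set.range A).ncard : ℝ) ≤ K * √2 ^ A.rank - 4 := by
  classical
  obtain ⟨C, hC, far_rows⟩ := exists_card_le_of_far_rows.{u}
  refine ⟨C + 5, by positivity, fun {V} _ A hA h01 => ?_⟩
  induction hr : A.rank using Nat.strong_induction_on generalizing V A with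
  | _ r ih =>
  obtain ⟨s, hs, hinj⟩ := exists_injective_submatrix hA
  let B : Matrix s s ℝ := A.submatrix Subtype.val Subtype.val
  have hB : B.IsSymm := hA.submatrix _
  have rank_le : B.rank ≤ r := (Matrix.rank_submatrix_le A _ _).trans_eq hr
  have card_le : (Fintype.card s : ℝ) ≤ (C + 5) * √2 ^ B.rank - 4 :=
    card_le_of_ncard_range_block_le hC hB (fun _ _ => h01 _ _) hinj
      (far_rows hB fun _ _ => h01 _ _) fun x hx hx0 =>
        ih _ ((rank_toSquareBlockProp_zeros_add_one_le hB hx hx0).trans rank_le) _ _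
          (hB.submatrix _) (fun _ _ => h01 _ _) rfl
  rw [← hs, ← Nat.card_coe_set_eq, Nat.card_eq_fintype_card]
  refine card_le.trans ?_
  gcongr
  exact Real.one_le_sqrt.2 one_le_two

end RowBound

section Twins

theorem twins_iff_row_eq {n : ℕ} {A : Matrix (Fin n) (Fin n) ℝ} (hdiag : ∀ i, A i i = 0)
    (u v : Fin n) : Twins A u v ↔ A u = A v :=
  ⟨fun h => funext h.2, fun h => ⟨by rw [h, hdiag], congrFun h⟩⟩

theorem exists_labelling_of_ncard_range_le {α β : Type*} [Finite α] (f : α → β) {m : ℕ}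
    (hm : (Set.range f).ncard ≤ m) : ∃ P : α → Fin m, ∀ u v, P u = P v ↔ f u = f v := by
  let e : Set.range f ≃ Fin (Set.range f).ncard := Finite.equivFinOfCardEq rfl
  exact ⟨fun v => Fin.castLE hm (e (Set.rangeFactorization f v)), fun u v => by
    rw [(Fin.castLE_injective hm).eq_iff, e.injective.eq_iff, Subtype.ext_iff,
      Set.rangeFactorization_coe, Set.rangeFactorization_coe]⟩

theorem two_rpow_half (k : ℕ) : (2 : ℝ) ^ ((k : ℝ) / 2) = √2 ^ k := by
  rw [Real.sqrt_eq_rpow, ← Real.rpow_mul_natCast zero_le_two, one_div_mul_eq_div]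

theorem isBigO_natCeil_mul_sqrt_two_pow {K : ℝ} (hK : 0 ≤ K) :
    (fun k : ℕ => (⌈K * √2 ^ k⌉₊ : ℝ)) =O[atTop] fun k : ℕ => (2 : ℝ) ^ ((k : ℝ) / 2) := by
  refine IsBigO.of_bound (K + 1) (Eventually.of_forall fun k => ?_)
  have one_le_pow : (1 : ℝ) ≤ √2 ^ k := one_le_pow₀ (Real.one_le_sqrt.2 one_le_two)
  rw [two_rpow_half, Real.norm_of_nonneg (by positivity), Real.norm_of_nonneg (by positivity)]
  linarith [Nat.ceil_lt_add_one (show 0 ≤ K * √2 ^ k by positivity)]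

end Twins

end KotlovLovasz

open KotlovLovasz in
theorem mainTheorem4 :
    ∃ f : ℕ → ℕ,
      (fun k => (f k : ℝ)) =O[atTop] (fun k : ℕ => (2 : ℝ) ^ ((k : ℝ) / 2)) ∧
      ∀ (k n : ℕ) (A : Matrix (Fin n) (Fin n) ℝ), A.IsAdjMatrix → A.rank ≤ k →
        (∃ P : Fin n → Fin (f k), ∀ u v, P u = P v ↔ Twins A u v) ∧
        ∀ P : Fin n → Fin (f k), IsCanonical A P →
          ∀ (ℓ : ℝ≥0) (i₀ : Fin n),
            IdentDistrib (process i₀) (process i₀) (mbpLaw A ℓ P i₀) (bpLaw A ℓ) := by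
  obtain ⟨K, hK, ncard_range_le⟩ := exists_ncard_range_le.{0}
  refine ⟨fun k => ⌈K * √2 ^ k⌉₊, isBigO_natCeil_mul_sqrt_two_pow hK, fun k n A hA hk =>
    ⟨?_, fun P hP ℓ i₀ => identDistrib_process_mbpLaw_bpLaw hA.symm hA.zero_or_one hP ℓ i₀⟩⟩
  have pow_le : √2 ^ A.rank ≤ √2 ^ k := pow_le_pow_right₀ (Real.one_le_sqrt.2 one_le_two) hk
  have rows_le : ((Set.range A).ncard : ℝ) ≤ K * √2 ^ k := by
    nlinarith [ncard_range_le hA.symm hA.zero_or_one]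
  simp only [twins_iff_row_eq hA.apply_diag]
  exact exists_labelling_of_ncard_range_le A (Nat.cast_le.1 (rows_le.trans (Nat.le_ceil _)))
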